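/- Let $U\subset\mathbb{R}$ be an open interval and let $\gamma\colon U\to S^2\subset\mathbb{R}^3$ be a $C^3$ curve on the unit sphere such that $\operatorname{span}\{\gamma(\theta),\dot\gamma(\theta),\ddot\gamma(\theta)\}=\mathbb{R}^3$ for every $\theta\in U$. For $\theta\in U$ let $\rho_\theta\colon\mathbb{R}^3\to\mathbb{R}$, $\rho_\theta(x)=\gamma(\theta)\cdot x$, be the orthogonal projection onto the line spanned by $\gamma(\theta)$ (identified with $\mathbb{R}$), and let $\pi_\theta$ be the orthogonal projection of $\mathbb{R}^3$ onto the plane $V_\theta=\gamma(\theta)^\perp$ (identified with $\mathbb{R}^2$). Let $B\subset\mathbb{R}^3$ be an analytic set, and let $\dim_{\mathrm H}$ denote Hausdorff dimension. (a) If $\dim_{\mathrm H}B\le 1/2$, then $\dim_{\mathrm H}\rho_\theta(B)=\dim_{\mathrm H}B$ for Lebesgue almost every $\theta\in U$. (b) If $\dim_{\mathrm H}B\le 1$, then $\dim_{\mathrm H}\pi_\theta(B)=\dim_{\mathrm H}B$ for Lebesgue almost every $\theta\in U$. -/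

import Mathlib

open MeasureTheory

/-- A non-degenerate curve: `U` is an open interval (possibly unbounded), `γ` maps `U` into the
unit sphere of Euclidean `ℝ³`, is of class `C³` on `U`, and for every `θ ∈ U` the vectors
`γ(θ)`, `γ'(θ)`, `γ''(θ)` span `ℝ³`. The values of `γ` outside the open set `U` play no role. -/
structure IsNonDegenerateCurve (U : Set ℝ) (γ : ℝ → EuclideanSpace ℝ (Fin 3)) : Prop where
  isOpen : IsOpen U
  ordConnected : U.OrdConnected
  norm_eq_one : ∀ θ ∈ U, ‖γ θ‖ = 1
  contDiffOn : ContDiffOn ℝ 3 γ U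
  span_eq_top : ∀ θ ∈ U, Submodule.span ℝ {γ θ, deriv γ θ, deriv (deriv γ) θ} = ⊤

/-- The projection `ρ_θ(x) = γ(θ) · x` onto the line spanned by `γ(θ)`, viewed as a map to `ℝ`. -/
noncomputable def lineProj (γ : ℝ → EuclideanSpace ℝ (Fin 3)) (θ : ℝ) :
    EuclideanSpace ℝ (Fin 3) → ℝ :=
  fun x => inner ℝ (γ θ) x

/-- The plane `V_θ`, the orthogonal complement of the line spanned by `γ(θ)`. -/
noncomputable def orthPlane (γ : ℝ → EuclideanSpace ℝ (Fin 3)) (θ : ℝ) :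
    Submodule ℝ (EuclideanSpace ℝ (Fin 3)) :=
  (Submodule.span ℝ {γ θ})ᗮ

/-- The orthogonal projection `π_θ` onto the plane `V_θ`, with values in the Euclidean plane
`V_θ` itself, which is isometric to `ℝ²` whenever `γ(θ) ≠ 0`. -/
noncomputable def planeProj (γ : ℝ → EuclideanSpace ℝ (Fin 3)) (θ : ℝ) :
    EuclideanSpace ℝ (Fin 3) → orthPlane γ θ :=
  fun x => (orthPlane γ θ).orthogonalProjectionOnto x

/-!
A projection with parameter `θ` nearly annihilates a unit vector `e` only for few `θ`. For the lines
this is because, locally uniformly in `θ`, one of `⟪γ, e⟫`, `⟪γ', e⟫`, `⟪γ'', e⟫` stays away from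
zero, so that `|⟪γ(θ), e⟫| < δ` only on a set of measure `O(δ ^ (1/2))`. For the planes it forces
`γ(θ)` to be within `O(δ)` of `e` or `-e`, which, since `γ' ≠ 0`, happens only on a set of measure
`O(δ)`.

Kaufman's energy argument turns such a bound of order `p` into the conservation of dimensions up to
`p`. If `s < dimH B ≤ p`, then `B` carries a measure `μ` of finite `s`-energy. Integrated over `θ`,
the `s`-energy of the image of `μ` is at most a constant times the `s`-energy of `μ`, hence finite
for almost every `θ`, and so the image of `B` has dimension at least `s`.

The measure `μ` comes from Frostman's lemma. The dyadic net content is continuous along increasing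
sequences of sets and grows at most by a constant factor on passing to a suitable neighbourhood, so
an analytic set of positive content has a compact subset of positive content. On the compact set, a
unit of mass flowing down the tree of dyadic cubes in proportion to their contents gives each cube
mass at most a constant times its content.
-/

open Set Filter Topology
open scoped ENNReal NNReal

section NetContent

variable {X J : Type*}

/-- A net of partitions: the cells of generation `k` are the fibres of `q k`, and the cells of
generation `k + 1` refine those of generation `k`. -/
def IsNet (q : ℕ → X → J) : Prop :=
  ∀ k x y, q (k + 1) x = q (k + 1) y → q k x = q k y

/-- The total weight of a family of cells, where `(k, j)` stands for the cell `{x | q k x = j}` of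
generation `k`, of weight `w k`. -/
noncomputable def cellCost (w : ℕ → ℝ≥0∞) (D : Set (ℕ × J)) : ℝ≥0∞ :=
  ∑' c : D, w c.1.1

/-- The family of cells `D` covers `E`. -/
def CellCover (q : ℕ → X → J) (D : Set (ℕ × J)) (E : Set X) : Prop :=
  ∀ x ∈ E, ∃ k, (k, q k x) ∈ D

/-- The cells of `D` that are not contained in a cell of `D` of an earlier generation. -/
def maximalCells (q : ℕ → X → J) (D : Set (ℕ × J)) : Set (ℕ × J) :=
  {c | c ∈ D ∧ ∀ x, q c.1 x = c.2 → ∀ j < c.1, (j, q j x) ∉ D}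

variable {q : ℕ → X → J} {w : ℕ → ℝ≥0∞} {D C : Set (ℕ × J)} {A E : Set X}

theorem IsNet.eq_of_le (hq : IsNet q) {j k : ℕ} (hjk : j ≤ k) {x y : X} (h : q k x = q k y) :
    q j x = q j y := by
  induction k, hjk using Nat.le_induction with
  | base => exact h
  | succ k _ ih => exact ih (hq k x y h)

theorem cellCost_union_add_inter :
    cellCost w (D ∪ C) + cellCost w (D ∩ C) = cellCost w D + cellCost w C := by
  simp only [cellCost, tsum_subtype _ fun c : ℕ × J => w c.1, ← ENNReal.tsum_add]
  exact tsum_congr fun c => congrFun (indicator_union_add_inter (fun c : ℕ × J => w c.1) D C) c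

theorem CellCover.mono_left (h : CellCover q D E) (hDC : D ⊆ C) : CellCover q C E := fun x hx =>
  (h x hx).imp fun _ hk => hDC hk

theorem CellCover.mono_right (h : CellCover q D E) (hAE : A ⊆ E) : CellCover q D A :=
  fun x hx => h x (hAE hx)

theorem CellCover.iUnion {ι : Type*} {D : ι → Set (ℕ × J)} {A : ι → Set X}
    (h : ∀ i, CellCover q (D i) (A i)) : CellCover q (⋃ i, D i) (⋃ i, A i) := fun x hx => by
  obtain ⟨i, hi⟩ := mem_iUnion.1 hx
  exact (h i).mono_left (subset_iUnion D i) x hi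

theorem maximalCells_subset : maximalCells q D ⊆ D := fun _ h => h.1

theorem mem_maximalCells_of_subset {c : ℕ × J} (h : D ⊆ C) (hc : c ∈ maximalCells q C)
    (hD : c ∈ D) : c ∈ maximalCells q D :=
  ⟨hD, fun x hx j hj hmem => hc.2 x hx j hj (h hmem)⟩

theorem CellCover.maximalCells (h : CellCover q D E) (hq : IsNet q) :
    CellCover q (maximalCells q D) E := by
  classical
  intro x hx
  refine ⟨Nat.find (h x hx), Nat.find_spec (h x hx), fun y hy j hj hmem => ?_⟩
  rw [hq.eq_of_le hj.le hy] at hmem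
  exact Nat.find_min (h x hx) hj hmem

/-- The infimum of the total weights of the families of cells covering a set: the net analogue of
the Hausdorff content. -/
noncomputable def netContent (q : ℕ → X → J) (w : ℕ → ℝ≥0∞) : OuterMeasure X where
  measureOf E := ⨅ (D : Set (ℕ × J)) (_ : CellCover q D E), cellCost w D
  empty := le_antisymm
    ((iInf₂_le ∅ fun _ hx => hx.elim).trans (by simp [cellCost])) zero_le
  mono hAE := le_iInf₂ fun D hD => iInf₂_le D (hD.mono_right hAE)
  iUnion_nat A _ := by
    refine ENNReal.le_of_forall_pos_le_add fun ε hε hsum => ?_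
    obtain ⟨δ, hδ, hδε⟩ := ENNReal.exists_pos_sum_of_countable (ENNReal.coe_pos.2 hε).ne' ℕ
    have hcover n : ∃ D, CellCover q D (A n) ∧
        cellCost w D < (⨅ (D) (_ : CellCover q D (A n)), cellCost w D) + δ n := by
      simpa only [iInf_lt_iff, exists_prop] using
        ENNReal.lt_add_right (ENNReal.ne_top_of_tsum_ne_top hsum.ne n)
          (ENNReal.coe_pos.2 (hδ n)).ne'
    choose D hD hcost using hcover
    calc ⨅ (D) (_ : CellCover q D (⋃ n, A n)), cellCost w D
        ≤ cellCost w (⋃ n, D n) := iInf₂_le _ (.iUnion hD)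
      _ ≤ ∑' n, cellCost w (D n) := ENNReal.tsum_iUnion_le_tsum (fun c : ℕ × J => w c.1) D
      _ ≤ ∑' n, ((⨅ (D) (_ : CellCover q D (A n)), cellCost w D) + δ n) :=
        ENNReal.tsum_le_tsum fun n => (hcost n).le
      _ ≤ _ := by rw [ENNReal.tsum_add]; gcongr

theorem netContent_apply :
    netContent q w E = ⨅ (D : Set (ℕ × J)) (_ : CellCover q D E), cellCost w D :=
  rfl

theorem netContent_le (h : CellCover q D E) : netContent q w E ≤ cellCost w D :=
  iInf₂_le D h

theorem netContent_lt_iff {b : ℝ≥0∞} :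
    netContent q w E < b ↔ ∃ D, CellCover q D E ∧ cellCost w D < b := by
  simp only [netContent_apply, iInf_lt_iff, exists_prop]

theorem netContent_cell_le (k : ℕ) (j : J) : netContent q w {x | q k x = j} ≤ w k :=
  (netContent_le (D := {(k, j)}) fun _ hx => ⟨k, congrArg (Prod.mk k) hx⟩).trans_eq
    (tsum_singleton (k, j) fun c : ℕ × J => w c.1)

theorem cellCost_maximalCells_union_add_netContent_le (hD : CellCover q D A)
    (hC : CellCover q C A) :
    cellCost w (maximalCells q (D ∪ C)) + netContent q w A ≤ cellCost w D + cellCost w C := by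
  -- A point of `A` lies in cells of both families; the larger one may be kept, and the smaller one
  -- then still covers the point.
  have hcov : CellCover q ((D ∪ C) \ maximalCells q (D ∪ C) ∪ D ∩ C) A := by
    intro x hx
    obtain ⟨k, hk⟩ := hD x hx
    obtain ⟨l, hl⟩ := hC x hx
    rcases lt_trichotomy k l with h | rfl | h
    · exact ⟨l, .inl ⟨.inr hl, fun hm => hm.2 x rfl k h (.inl hk)⟩⟩
    · exact ⟨k, .inr ⟨hk, hl⟩⟩
    · exact ⟨k, .inl ⟨.inl hk, fun hm => hm.2 x rfl l h (.inr hl)⟩⟩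
  have hsplit : cellCost w (maximalCells q (D ∪ C)) +
      cellCost w ((D ∪ C) \ maximalCells q (D ∪ C)) = cellCost w (D ∪ C) := by
    rw [← cellCost_union_add_inter, union_sdiff_cancel maximalCells_subset, inter_sdiff_self]
    simp [cellCost]
  calc _ ≤ cellCost w (maximalCells q (D ∪ C)) +
        (cellCost w ((D ∪ C) \ maximalCells q (D ∪ C)) + cellCost w (D ∩ C)) := by
        gcongr
        exact (netContent_le hcov).trans (ENNReal.tsum_union_le (fun c : ℕ × J => w c.1) _ _)
    _ = _ := by rw [← add_assoc, hsplit, cellCost_union_add_inter]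

theorem cellCost_le_of_forall_eventually_mem {D : ℕ → Set (ℕ × J)} {b : ℝ≥0∞}
    (hC : ∀ c ∈ C, ∀ᶠ n in atTop, c ∈ D n) (hD : ∀ n, cellCost w (D n) ≤ b) :
    cellCost w C ≤ b := by
  refine ENNReal.summable.tsum_le_of_sum_le fun s => ?_
  obtain ⟨n, hn⟩ := ((Finset.eventually_all s).2 fun c _ => hC c.1 c.2).exists
  calc ∑ c ∈ s, w c.1.1
      = ∑ c ∈ s.map (.subtype _), (D n).indicator (fun c => w c.1) c := by
        rw [Finset.sum_map]
        exact Finset.sum_congr rfl fun c hc => (indicator_of_mem (hn c hc) fun c => w c.1).symm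
    _ ≤ ∑' c, (D n).indicator (fun c => w c.1) c := ENNReal.sum_le_tsum _
    _ = cellCost w (D n) := (tsum_subtype _ _).symm
    _ ≤ b := hD n

/-- The families obtained from `C 0` by successively adjoining `C 1, C 2, …` and discarding the
cells that become redundant at each step. -/
def mergedCover (q : ℕ → X → J) (C : ℕ → Set (ℕ × J)) : ℕ → Set (ℕ × J)
  | 0 => C 0
  | n + 1 => maximalCells q (mergedCover q C n ∪ C (n + 1))

section mergedCover

variable {C : ℕ → Set (ℕ × J)} {A : ℕ → Set X}

theorem mergedCover_subset (n : ℕ) : mergedCover q C n ⊆ ⋃ m, C m := by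
  induction n with
  | zero => exact subset_iUnion C 0
  | succ n ih => exact maximalCells_subset.trans (union_subset ih (subset_iUnion C (n + 1)))

theorem CellCover.mergedCover (hC : ∀ n, CellCover q (C n) (A n)) (hq : IsNet q) :
    ∀ n, CellCover q (mergedCover q C n) (A n)
  | 0 => hC 0
  | n + 1 => ((hC (n + 1)).mono_left subset_union_right).maximalCells hq

theorem eventually_mem_mergedCover {c : ℕ × J} (hc : c ∈ maximalCells q (⋃ m, C m)) :
    ∀ᶠ n in atTop, c ∈ mergedCover q C n := by
  have hsub n : mergedCover q C n ∪ C (n + 1) ⊆ ⋃ m, C m :=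
    union_subset (mergedCover_subset n) (subset_iUnion C (n + 1))
  obtain ⟨m, hm⟩ := mem_iUnion.1 (maximalCells_subset hc)
  refine eventually_atTop.2 ⟨m, fun n hn => ?_⟩
  induction n, hn using Nat.le_induction with
  | base =>
    cases m with
    | zero => exact hm
    | succ m => exact mem_maximalCells_of_subset (hsub m) hc (.inr hm)
  | succ n _ ih => exact mem_maximalCells_of_subset (hsub n) hc (.inl ih)

theorem cellCost_mergedCover_le (hq : IsNet q) (hA : Monotone A)
    (hC : ∀ n, CellCover q (C n) (A n)) (hfin : ∀ n, netContent q w (A n) ≠ ∞) {δ : ℕ → ℝ≥0∞}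
    (hcost : ∀ n, cellCost w (C n) ≤ netContent q w (A n) + δ n) (n : ℕ) :
    cellCost w (mergedCover q C n) ≤ netContent q w (A n) + ∑ m ∈ Finset.range (n + 1), δ m := by
  induction n with
  | zero => simpa [mergedCover] using hcost 0
  | succ n ih =>
    refine (ENNReal.add_le_add_iff_right (hfin n)).1 ?_
    calc cellCost w (mergedCover q C (n + 1)) + netContent q w (A n)
        ≤ cellCost w (mergedCover q C n) + cellCost w (C (n + 1)) :=
          cellCost_maximalCells_union_add_netContent_le (CellCover.mergedCover hC hq n)
            ((hC (n + 1)).mono_right (hA n.le_succ))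
      _ ≤ (netContent q w (A n) + ∑ m ∈ Finset.range (n + 1), δ m) +
          (netContent q w (A (n + 1)) + δ (n + 1)) := add_le_add ih (hcost (n + 1))
      _ = _ := by rw [Finset.sum_range_succ _ (n + 1)]; ring

end mergedCover

theorem netContent_iUnion_le_iSup (hq : IsNet q) {A : ℕ → Set X} (hA : Monotone A) :
    netContent q w (⋃ n, A n) ≤ ⨆ n, netContent q w (A n) := by
  refine ENNReal.le_of_forall_pos_le_add fun ε hε htop => ?_
  obtain ⟨δ, hδ, hsum⟩ := ENNReal.exists_pos_sum_of_countable (ENNReal.coe_pos.2 hε).ne' ℕ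
  have hfin n : netContent q w (A n) ≠ ∞ :=
    ne_top_of_le_ne_top htop.ne (le_iSup (fun n => netContent q w (A n)) n)
  choose C hC hcost using fun n => netContent_lt_iff.1
    (ENNReal.lt_add_right (hfin n) (ENNReal.coe_pos.2 (hδ n)).ne')
  refine (netContent_le ((CellCover.iUnion hC).maximalCells hq)).trans
    (cellCost_le_of_forall_eventually_mem (fun _ => eventually_mem_mergedCover) fun n => ?_)
  calc cellCost w (mergedCover q C n)
      ≤ netContent q w (A n) + ∑ m ∈ Finset.range (n + 1), (δ m : ℝ≥0∞) :=
        cellCost_mergedCover_le hq hA hC hfin (fun n => (hcost n).le) n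
    _ ≤ _ := add_le_add (le_iSup (fun n => netContent q w (A n)) n)
        ((ENNReal.sum_le_tsum _).trans hsum.le)

end NetContent

section Capacitability

theorem exists_forall_lt_le_subset_of_isOpen {N : ℕ → ℕ} {V : Set (ℕ → ℕ)} (hV : IsOpen V)
    (hNV : Iic N ⊆ V) : ∃ k, {σ : ℕ → ℕ | ∀ i < k, σ i ≤ N i} ⊆ V := by
  by_contra! h
  choose σ hσ hσV using fun k => not_subset.1 (h k)
  obtain ⟨τ, hτ, φ, hφ, hlim⟩ : ∃ τ ∈ Icc 0 N, ∃ φ : ℕ → ℕ, StrictMono φ ∧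
      Tendsto ((fun k => σ k ⊓ N) ∘ φ) atTop (𝓝 τ) :=
    isCompact_Icc.tendsto_subseq fun k => ⟨zero_le, inf_le_right⟩
  have hlim' : Tendsto (σ ∘ φ) atTop (𝓝 τ) := by
    rw [tendsto_pi_nhds] at hlim ⊢
    intro i
    refine (hlim i).congr' ?_
    filter_upwards [hφ.tendsto_atTop.eventually_gt_atTop i] with k hk
    exact inf_eq_left.2 (hσ (φ k) i hk)
  obtain ⟨k, hk⟩ := (hlim'.eventually (hV.mem_nhds (hNV hτ.2))).exists
  exact hσV _ hk

variable {X : Type*} {ν : Set X → ℝ≥0∞} {c : ℝ≥0∞}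

theorem exists_forall_lt_image_setOf_forall_lt_le
    (hν : ∀ A : ℕ → Set X, Monotone A → ν (⋃ n, A n) ≤ ⨆ n, ν (A n)) {f : (ℕ → ℕ) → X}
    (hc : c < ν (range f)) : ∃ N : ℕ → ℕ, ∀ k, c < ν (f '' {σ | ∀ i < k, σ i ≤ N i}) := by
  have hstep (k : ℕ) (S : Set (ℕ → ℕ)) (hS : c < ν (f '' S)) :
      ∃ n, c < ν (f '' (S ∩ {σ | σ k ≤ n})) := by
    have hunion : ⋃ n, f '' (S ∩ {σ | σ k ≤ n}) = f '' S := by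
      rw [← image_iUnion, ← inter_iUnion]
      exact congrArg _ (inter_eq_left.2 fun σ _ => mem_iUnion.2 ⟨σ k, le_refl (σ k)⟩)
    rw [← hunion] at hS
    exact lt_iSup_iff.1 (hS.trans_le (hν _ fun m n hmn =>
      image_mono (inter_subset_inter_right S fun σ hσ => le_trans hσ hmn)))
  choose! n hn using hstep
  let S : ℕ → Set (ℕ → ℕ) := fun k => Nat.rec univ (fun k S => S ∩ {σ | σ k ≤ n k S}) k
  have hS_eq k : S k = {σ | ∀ i < k, σ i ≤ n i (S i)} := by
    induction k with
    | zero => simp [S]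
    | succ k ih =>
      ext σ
      simp only [show S (k + 1) = S k ∩ {σ | σ k ≤ n k (S k)} from rfl, Nat.forall_lt_succ_right,
        mem_inter_iff, mem_ofPred_eq]
      exact and_congr_left fun _ => Set.ext_iff.1 ih σ
  refine ⟨fun i => n i (S i), fun k => ?_⟩
  rw [← hS_eq]
  induction k with
  | zero => simpa [S] using hc
  | succ k ih => exact hn k (S k) ih

-- A variant of Choquet's capacitability theorem: instead of continuity of `ν` along decreasing
-- compact sets, the conclusion bounds `ν` on the open neighbourhoods of `K`.
theorem exists_isCompact_forall_isOpen_lt_of_analyticSet [TopologicalSpace X] (hν_mono : Monotone ν)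
    (hν : ∀ A : ℕ → Set X, Monotone A → ν (⋃ n, A n) ≤ ⨆ n, ν (A n)) {B : Set X}
    (hB : AnalyticSet B) (hc : c < ν B) :
    ∃ K ⊆ B, IsCompact K ∧ ∀ V, IsOpen V → K ⊆ V → c < ν V := by
  rw [AnalyticSet] at hB
  obtain rfl | ⟨f, hf, rfl⟩ := hB
  · exact ⟨∅, Subset.rfl, isCompact_empty, fun V _ hV => hc.trans_le (hν_mono hV)⟩
  obtain ⟨N, hN⟩ := exists_forall_lt_image_setOf_forall_lt_le hν hc
  refine ⟨f '' Icc 0 N, image_subset_range _ _, isCompact_Icc.image hf, fun V hV hKV => ?_⟩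
  obtain ⟨k, hk⟩ := exists_forall_lt_le_subset_of_isOpen (hV.preimage hf)
    fun σ hσ => image_subset_iff.1 hKV ⟨zero_le, hσ⟩
  exact (hN k).trans_le (hν_mono (image_subset_iff.2 hk))

end Capacitability

section Flow

variable {X J : Type*}

/-- A unit flow on the forest with vertices `(k, v)`, where `(k + 1, u)` is a child of
`(k, par u)`. -/
structure IsUnitFlow (par : J → J) (f : ℕ → J → ℝ≥0∞) : Prop where
  tsum_zero : ∑' v, f 0 v = 1
  tsum_fiber : ∀ k v, ∑' u : par ⁻¹' {v}, f (k + 1) u = f k v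

open Classical in
/-- The flow issuing from `v₀` that divides itself among the children of each vertex in proportion
to the capacities `a`. -/
noncomputable def proportionalFlow (par : J → J) (a : ℕ → J → ℝ≥0∞) (v₀ : J) : ℕ → J → ℝ≥0∞
  | 0, v => if v = v₀ then 1 else 0
  | k + 1, u => proportionalFlow par a v₀ k (par u) *
      (a (k + 1) u / ∑' u' : par ⁻¹' {par u}, a (k + 1) u')

variable {par : J → J} {a : ℕ → J → ℝ≥0∞} {v₀ : J}

theorem proportionalFlow_le (hsub : ∀ k v, a k v ≤ ∑' u : par ⁻¹' {v}, a (k + 1) u)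
    (h0 : a 0 v₀ ≠ 0) (htop : a 0 v₀ ≠ ∞) (k : ℕ) (v : J) :
    proportionalFlow par a v₀ k v ≤ a k v / a 0 v₀ := by
  induction k generalizing v with
  | zero =>
    rw [proportionalFlow]
    split_ifs with h
    · rw [h, ENNReal.div_self h0 htop]
    · exact zero_le
  | succ k ih =>
    let S := ∑' u : par ⁻¹' {par v}, a (k + 1) u
    calc proportionalFlow par a v₀ k (par v) * (a (k + 1) v / S)
        ≤ S / a 0 v₀ * (a (k + 1) v / S) := by
          gcongr
          exact (ih _).trans (ENNReal.div_le_div_right (hsub _ _) _)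
      _ = S * (a (k + 1) v / S) / a 0 v₀ := by simp only [div_eq_mul_inv]; ring
      _ ≤ a (k + 1) v / a 0 v₀ := by gcongr; exact ENNReal.mul_div_le

theorem isUnitFlow_proportionalFlow (hsub : ∀ k v, a k v ≤ ∑' u : par ⁻¹' {v}, a (k + 1) u)
    (hsum : ∀ k v, ∑' u : par ⁻¹' {v}, a (k + 1) u ≠ ∞) (h0 : a 0 v₀ ≠ 0) :
    IsUnitFlow par (proportionalFlow par a v₀) where
  tsum_zero := by simp [proportionalFlow]
  tsum_fiber k v := by
    let S := ∑' u : par ⁻¹' {v}, a (k + 1) u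
    have hchild (u : par ⁻¹' {v}) : proportionalFlow par a v₀ (k + 1) u =
        proportionalFlow par a v₀ k v * (a (k + 1) u / S) := by
      rw [proportionalFlow, show par u = v from u.2]
    rw [tsum_congr hchild, ENNReal.tsum_mul_left]
    simp only [div_eq_mul_inv]
    rw [ENNReal.tsum_mul_right]
    by_cases hS : S = 0
    · have hv : a k v = 0 := nonpos_iff_eq_zero.1 ((hsub k v).trans_eq hS)
      have hle := proportionalFlow_le hsub h0 (ne_top_of_le_ne_top (hsum 0 v₀) (hsub 0 v₀)) k v
      rw [hv, ENNReal.zero_div, nonpos_iff_eq_zero] at hle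
      rw [hle, zero_mul]
    · rw [ENNReal.mul_inv_cancel hS (hsum k v), mul_one]

theorem tsum_comp_mul_eq_of_fiber_tsum {f : J → ℝ≥0∞} {g : X → ℝ≥0∞} (p : X → J)
    (hfg : ∀ v, ∑' u : p ⁻¹' {v}, g u = f v) (φ : J → ℝ≥0∞) :
    ∑' u, φ (p u) * g u = ∑' v, φ v * f v := by
  rw [← ENNReal.tsum_fiberwise (fun u => φ (p u) * g u) p]
  refine tsum_congr fun v => ?_
  rw [← hfg v, ← ENNReal.tsum_mul_left]
  refine tsum_congr fun u => ?_
  rw [show p u = v from u.2]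

variable {q : ℕ → X → J} {f : ℕ → J → ℝ≥0∞} {c : ℕ → J → X}

theorem isNet_of_comp_eq (hpar : ∀ k x, par (q (k + 1) x) = q k x) : IsNet q := fun k x y h => by
  rw [← hpar, h, hpar]

theorem IsUnitFlow.tsum_comp_mul_eq (hf : IsUnitFlow par f)
    (hpar : ∀ k x, par (q (k + 1) x) = q k x) (hc : ∀ k v, f k v ≠ 0 → q k (c k v) = v)
    (ψ : J → ℝ≥0∞) {k m : ℕ} (hkm : k ≤ m) :
    ∑' u, ψ (q k (c m u)) * f m u = ∑' v, ψ v * f k v := by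
  induction m, hkm using Nat.le_induction with
  | base =>
    refine tsum_congr fun v => ?_
    by_cases hv : f k v = 0
    · simp [hv]
    · rw [hc k v hv]
  | succ m hkm ih =>
    rw [← ih, ← tsum_comp_mul_eq_of_fiber_tsum par (hf.tsum_fiber m) fun v => ψ (q k (c m v))]
    refine tsum_congr fun u => ?_
    by_cases hu : f (m + 1) u = 0
    · simp [hu]
    have hpu : f m (par u) ≠ 0 := fun hz =>
      hu (ENNReal.tsum_eq_zero.1 ((hf.tsum_fiber m (par u)).trans hz) ⟨u, rfl⟩)
    have hcell : q m (c (m + 1) u) = q m (c m (par u)) := by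
      rw [hc m _ hpu, ← hpar, hc (m + 1) u hu]
    rw [(isNet_of_comp_eq hpar).eq_of_le hkm hcell]

theorem exists_isUnitFlow_le_mul_netContent [Countable J] {w : ℕ → ℝ≥0∞} (hw : ∀ k, w k ≠ ∞)
    (hpar : ∀ k x, par (q (k + 1) x) = q k x) (hfib : ∀ v, (par ⁻¹' {v}).Finite)
    (h0 : netContent q w univ ≠ 0) :
    ∃ f, IsUnitFlow par f ∧ ∃ C ≠ ∞, ∀ k v, f k v ≤ C * netContent q w {x | q k x = v} := by
  let a : ℕ → J → ℝ≥0∞ := fun k v => netContent q w {x | q k x = v}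
  have htop k v : a k v ≠ ∞ := ne_top_of_le_ne_top (hw k) (netContent_cell_le k v)
  have hsub k v : a k v ≤ ∑' u : par ⁻¹' {v}, a (k + 1) u := by
    refine (measure_mono fun x hx => ?_).trans (measure_iUnion_le _)
    exact mem_iUnion.2 ⟨⟨q (k + 1) x, (hpar k x).trans hx⟩, rfl⟩
  have hsum k v : ∑' u : par ⁻¹' {v}, a (k + 1) u ≠ ∞ := by
    have := (hfib v).fintype
    rw [tsum_fintype]
    exact ENNReal.sum_ne_top.2 fun u _ => htop (k + 1) u
  obtain ⟨v₀, hv₀⟩ : ∃ v₀, a 0 v₀ ≠ 0 := by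
    by_contra! h
    refine h0 (measure_mono_null (fun x _ => ?_) (measure_iUnion_null h))
    exact mem_iUnion.2 ⟨q 0 x, rfl⟩
  refine ⟨proportionalFlow par a v₀, isUnitFlow_proportionalFlow hsub hsum hv₀, (a 0 v₀)⁻¹,
    ENNReal.inv_ne_top.2 hv₀, fun k v => ?_⟩
  rw [mul_comm, ← div_eq_mul_inv]
  exact proportionalFlow_le hsub hv₀ (htop 0 v₀) k v

/-- The discrete measure with mass `f u` at `c u`. -/
noncomputable def atomicMeasure [MeasurableSpace X] (f : J → ℝ≥0∞) (c : J → X) : Measure X :=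
  .sum fun u => f u • .dirac (c u)

variable [MeasurableSpace X]

theorem atomicMeasure_apply {f : J → ℝ≥0∞} {c : J → X} {G : Set X} (hG : MeasurableSet G) :
    atomicMeasure f c G = ∑' u, G.indicator 1 (c u) * f u := by
  simp [atomicMeasure, Measure.sum_apply _ hG, Measure.dirac_apply' _ hG, mul_comm]

theorem IsUnitFlow.isProbabilityMeasure_atomicMeasure (hf : IsUnitFlow par f)
    (hpar : ∀ k x, par (q (k + 1) x) = q k x) (hc : ∀ k v, f k v ≠ 0 → q k (c k v) = v) (m : ℕ) :
    IsProbabilityMeasure (atomicMeasure (f m) (c m)) where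
  measure_univ := by
    simpa [atomicMeasure_apply, hf.tsum_zero] using hf.tsum_comp_mul_eq hpar hc 1 m.zero_le

theorem IsUnitFlow.atomicMeasure_le (hf : IsUnitFlow par f)
    (hpar : ∀ k x, par (q (k + 1) x) = q k x) (hc : ∀ k v, f k v ≠ 0 → q k (c k v) = v)
    {k m : ℕ} (hkm : k ≤ m) {G : Set X} (hG : MeasurableSet G) {F : Finset J}
    (hGF : MapsTo (q k) G F) : atomicMeasure (f m) (c m) G ≤ ∑ v ∈ F, f k v :=
  calc atomicMeasure (f m) (c m) G
      = ∑' u, G.indicator 1 (c m u) * f m u := atomicMeasure_apply hG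
    _ ≤ ∑' u, (F : Set J).indicator 1 (q k (c m u)) * f m u := by
      gcongr with u
      exact indicator_le (fun x hx => (indicator_of_mem (hGF hx) 1).ge) _
    _ = ∑' v, (F : Set J).indicator 1 v * f k v := hf.tsum_comp_mul_eq hpar hc _ hkm
    _ = ∑ v ∈ F, f k v := by
      rw [tsum_eq_sum (s := F) fun v hv => by simp [hv]]
      exact Finset.sum_congr rfl fun v hv => by simp [hv]

variable [TopologicalSpace X] [BorelSpace X] [CompactSpace X] [T2Space X]
  [TopologicalSpace.PseudoMetrizableSpace X]

theorem exists_probabilityMeasure_forall_isOpen_le (P : ℕ → ProbabilityMeasure X) :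
    ∃ μ : ProbabilityMeasure X, ∀ (G : Set X) (b : ℝ≥0∞), IsOpen G →
      (∀ᶠ m in atTop, (P m : Measure X) G ≤ b) → (μ : Measure X) G ≤ b := by
  let L : Ultrafilter (ProbabilityMeasure X) := (hyperfilter ℕ).map P
  refine ⟨L.lim, fun G b hG hb => ?_⟩
  calc (L.lim : Measure X) G
      ≤ liminf (fun m => (P m : Measure X) G) (hyperfilter ℕ : Filter ℕ) :=
        ProbabilityMeasure.le_liminf_measure_open_of_tendsto L.le_nhds_lim hG
    _ ≤ b := liminf_le_of_frequently_le' (Eventually.frequently (Nat.hyperfilter_le_atTop hb))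

theorem exists_probabilityMeasure_le_of_netContent_ne_zero [Countable J] {w : ℕ → ℝ≥0∞}
    (hw : ∀ k, w k ≠ ∞) (hpar : ∀ k x, par (q (k + 1) x) = q k x)
    (hfib : ∀ v, (par ⁻¹' {v}).Finite) (h0 : netContent q w univ ≠ 0) :
    ∃ (μ : ProbabilityMeasure X) (C : ℝ≥0∞), C ≠ ∞ ∧ ∀ (k : ℕ) (G : Set X) (F : Finset J),
      IsOpen G → MapsTo (q k) G F → (μ : Measure X) G ≤ F.card * (C * w k) := by
  obtain ⟨f, hf, C, hC, hfC⟩ := exists_isUnitFlow_le_mul_netContent hw hpar hfib h0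
  have : Nonempty X := not_isEmpty_iff.1 fun _ => h0 (by simp [univ_eq_empty_iff.2 ‹_›])
  have hpoint k v : ∃ x, f k v ≠ 0 → q k x = v := by
    by_contra! h
    have hempty : {x | q k x = v} = ∅ := eq_empty_of_forall_notMem fun x => (h x).2
    refine (h (Classical.arbitrary X)).1 (nonpos_iff_eq_zero.1 ((hfC k v).trans_eq ?_))
    rw [hempty, measure_empty, mul_zero]
  choose c hc using hpoint
  obtain ⟨μ, hμ⟩ := exists_probabilityMeasure_forall_isOpen_le fun m =>
    ⟨atomicMeasure (f m) (c m), hf.isProbabilityMeasure_atomicMeasure hpar hc m⟩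
  refine ⟨μ, C, hC, fun k G F hG hGF => hμ G _ hG ?_⟩
  filter_upwards [eventually_ge_atTop k] with m hm
  calc atomicMeasure (f m) (c m) G
      ≤ ∑ v ∈ F, f k v := hf.atomicMeasure_le hpar hc hm hG.measurableSet hGF
    _ ≤ ∑ _v ∈ F, C * w k := by
      gcongr
      exact (hfC k _).trans (mul_le_mul_right (netContent_cell_le k _) C)
    _ = F.card * (C * w k) := by simp

end Flow

section Dyadic

/-- The weight `(2⁻ᵏ)ᵗ` of a cell of generation `k`, for nets whose cells of generation `k` have
diameter comparable to `2⁻ᵏ`. -/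
noncomputable def dyadicWeight (t : ℝ) (k : ℕ) : ℝ≥0∞ := (2⁻¹ ^ k : ℝ≥0∞) ^ t

theorem dyadicWeight_ne_top {t : ℝ} (ht : 0 ≤ t) (k : ℕ) : dyadicWeight t k ≠ ∞ :=
  ENNReal.rpow_ne_top_of_nonneg ht (ENNReal.pow_ne_top (by simp))

theorem dyadicWeight_ne_zero {t : ℝ} (ht : 0 ≤ t) (k : ℕ) : dyadicWeight t k ≠ 0 := by
  simp [dyadicWeight, ENNReal.rpow_eq_zero_iff, ht.not_gt]

theorem tendsto_const_mul_inv_two_pow (κ : ℝ≥0) :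
    Tendsto (fun n : ℕ => κ * (2⁻¹ : ℝ≥0∞) ^ n) atTop (𝓝 0) := by
  simpa using ENNReal.Tendsto.const_mul (a := (κ : ℝ≥0∞))
    (ENNReal.tendsto_pow_atTop_nhds_zero_of_lt_one (ENNReal.inv_lt_one.2 ENNReal.one_lt_two))
    (.inr ENNReal.coe_ne_top)

theorem tendsto_const_mul_dyadicWeight (κ : ℝ≥0) {t : ℝ} (ht : 0 < t) :
    Tendsto (fun n => κ ^ t * dyadicWeight t n) atTop (𝓝 0) := by
  simpa [Function.comp_def, dyadicWeight, ENNReal.mul_rpow_of_nonneg, ht.le,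
    ENNReal.zero_rpow_of_pos ht] using
    ((ENNReal.continuous_rpow_const (y := t)).tendsto 0).comp (tendsto_const_mul_inv_two_pow κ)

theorem hausdorffMeasure_eq_zero_of_netContent_eq_zero {X J : Type*} [EMetricSpace X]
    [MeasurableSpace X] [BorelSpace X] [Countable J] {q : ℕ → X → J} {κ : ℝ≥0}
    (hq : ∀ k x y, q k x = q k y → edist x y ≤ κ * 2⁻¹ ^ k) {t : ℝ} (ht : 0 < t) {E : Set X}
    (h : netContent q (dyadicWeight t) E = 0) : μH[t] E = 0 := by
  choose D hD hcost using fun n => netContent_lt_iff.1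
    (h.trans_lt (pos_iff_ne_zero.2 (dyadicWeight_ne_zero ht.le n)))
  let T n (c : D n) : Set X := {x | q c.1.1 x = c.1.2}
  have hdiam n (c : D n) : Metric.ediam (T n c) ≤ κ * 2⁻¹ ^ c.1.1 :=
    Metric.ediam_le fun x hx y hy => hq _ x y (Eq.trans hx (Eq.symm hy))
  have hscale n (c : D n) : (2⁻¹ : ℝ≥0∞) ^ c.1.1 ≤ 2⁻¹ ^ n :=
    (ENNReal.rpow_le_rpow_iff ht).1 ((ENNReal.le_tsum c).trans (hcost n).le)
  have hsum n : ∑' c : D n, Metric.ediam (T n c) ^ t ≤ κ ^ t * dyadicWeight t n :=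
    calc ∑' c : D n, Metric.ediam (T n c) ^ t
        ≤ ∑' c : D n, κ ^ t * dyadicWeight t c.1.1 := by
          gcongr with c
          rw [dyadicWeight, ← ENNReal.mul_rpow_of_nonneg _ _ ht.le]
          exact ENNReal.rpow_le_rpow (hdiam n c) ht.le
      _ = κ ^ t * cellCost (dyadicWeight t) (D n) := ENNReal.tsum_mul_left
      _ ≤ κ ^ t * dyadicWeight t n := by gcongr; exact (hcost n).le
  refine nonpos_iff_eq_zero.1 ((Measure.hausdorffMeasure_le_liminf_tsum t E _
    (tendsto_const_mul_inv_two_pow κ) T (.of_forall fun n c => ?_)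
    (.of_forall fun n x hx => ?_)).trans_eq (Tendsto.liminf_eq ?_))
  · exact (hdiam n c).trans (mul_le_mul_right (hscale n c) _)
  · obtain ⟨k, hk⟩ := hD n x hx
    exact mem_iUnion.2 ⟨⟨_, hk⟩, rfl⟩
  · exact tendsto_of_tendsto_of_tendsto_of_le_of_le tendsto_const_nhds
      (tendsto_const_mul_dyadicWeight κ ht) (fun _ => zero_le) hsum

variable {ι : Type*}

/-- The index of the half-open dyadic cube of side length `2⁻ᵏ` that contains `x`. -/
noncomputable def dyadicIndex (k : ℕ) (x : EuclideanSpace ℝ ι) : ι → ℤ :=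
  fun i => ⌊2 ^ k * x i⌋

/-- The index of the dyadic cube containing the cube of the next generation with index `v`. -/
def parentIndex (v : ι → ℤ) : ι → ℤ := fun i => v i / 2

theorem parentIndex_dyadicIndex_succ (k : ℕ) (x : EuclideanSpace ℝ ι) :
    parentIndex (dyadicIndex (k + 1) x) = dyadicIndex k x := by
  ext i
  calc ⌊2 ^ (k + 1) * x i⌋ / 2
      = ⌊2 ^ (k + 1) * x i / (2 : ℕ)⌋ := (Int.floor_div_natCast _ 2).symm
    _ = ⌊2 ^ k * x i⌋ := by congr 1; push_cast; ring

theorem finite_parentIndex_preimage [Finite ι] (v : ι → ℤ) : (parentIndex ⁻¹' {v}).Finite := by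
  have := Fintype.ofFinite ι
  classical
  refine (finite_Icc (fun i => 2 * v i) (fun i => 2 * v i + 1)).subset fun u hu => ?_
  have hdiv i : u i / 2 = v i := congrFun hu i
  exact ⟨fun i => by grind, fun i => by grind⟩

theorem inv_two_pow_eq_ofReal (k : ℕ) : (2⁻¹ ^ k : ℝ≥0∞) = ENNReal.ofReal (2 ^ k)⁻¹ := by
  rw [ENNReal.ofReal_inv_of_pos (by positivity), ENNReal.ofReal_pow (by norm_num),
    ENNReal.ofReal_ofNat, ENNReal.inv_pow]

variable (ι) in
theorem exists_edist_le_of_dyadicIndex_eq [Fintype ι] :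
    ∃ κ : ℝ≥0, ∀ (k : ℕ) (x y : EuclideanSpace ℝ ι), dyadicIndex k x = dyadicIndex k y →
      edist x y ≤ κ * 2⁻¹ ^ k := by
  refine ⟨_, fun k x y h => (PiLp.antilipschitzWith_ofLp 2 (fun _ : ι => ℝ) x y).trans
    (mul_le_mul_right ?_ _)⟩
  refine edist_pi_le_iff.2 fun i => ?_
  have hlt : |(2 : ℝ) ^ k * x i - 2 ^ k * y i| < 1 :=
    Int.abs_sub_lt_one_of_floor_eq_floor (congrFun h i)
  rw [← mul_sub, abs_mul, abs_of_pos (by positivity), mul_comm,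
    ← lt_div_iff₀ (by positivity), one_div] at hlt
  rw [edist_dist, Real.dist_eq, inv_two_pow_eq_ofReal]
  exact ENNReal.ofReal_le_ofReal hlt.le

theorem dyadicIndex_mem_Icc [Fintype ι] [DecidableEq ι] {k : ℕ} {x y : EuclideanSpace ℝ ι}
    (h : edist y x < 2⁻¹ ^ k) :
    dyadicIndex k y ∈ Finset.Icc (dyadicIndex k x - 1) (dyadicIndex k x + 1) := by
  rw [inv_two_pow_eq_ofReal, edist_lt_ofReal, dist_eq_norm] at h
  have hcoord i : |2 ^ k * y i - 2 ^ k * x i| < 1 := by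
    have hi : |y i - x i| < (2 ^ k)⁻¹ := (PiLp.norm_apply_le (y - x) i).trans_lt h
    rwa [← mul_sub, abs_mul, abs_of_pos (by positivity), mul_comm,
      ← lt_div_iff₀ (by positivity), one_div]
  refine Finset.mem_Icc.2 ⟨fun i => ?_, fun i => ?_⟩
  · exact (Int.floor_sub_one _).symm.trans_le
      (Int.floor_le_floor (by linarith [(abs_lt.1 (hcoord i)).1]))
  · exact (Int.floor_le_floor (by linarith [(abs_lt.1 (hcoord i)).2])).trans_eq
      (Int.floor_add_one _)

theorem card_Icc_sub_one_add_one [Fintype ι] [DecidableEq ι] (v : ι → ℤ) :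
    (Finset.Icc (v - 1) (v + 1)).card = 3 ^ Fintype.card ι := by
  have hside i : (Finset.Icc ((v - 1) i) ((v + 1) i)).card = 3 := by simp; omega
  rw [Pi.card_Icc, Finset.prod_congr rfl fun i _ => hside i, Finset.prod_const, Finset.card_univ]

theorem netContent_le_card_mul {X J : Type*} {q : ℕ → X → J} {w : ℕ → ℝ≥0∞} {E : Set X} {k : ℕ}
    {F : Finset J} (h : MapsTo (q k) E F) : netContent q w E ≤ F.card * w k :=
  calc netContent q w E
      ≤ netContent q w (⋃ v ∈ F, {x | q k x = v}) :=
        measure_mono fun x hx => mem_iUnion₂.2 ⟨q k x, h hx, rfl⟩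
    _ ≤ ∑ v ∈ F, netContent q w {x | q k x = v} := measure_biUnion_finset_le F _
    _ ≤ ∑ _v ∈ F, w k := Finset.sum_le_sum fun v _ => netContent_cell_le k v
    _ = F.card * w k := by simp

theorem exists_isOpen_netContent_dyadicIndex_le [Fintype ι] {w : ℕ → ℝ≥0∞}
    {E : Set (EuclideanSpace ℝ ι)} {b : ℝ≥0∞} (h : netContent dyadicIndex w E < b) :
    ∃ V, IsOpen V ∧ E ⊆ V ∧ netContent dyadicIndex w V ≤ 3 ^ Fintype.card ι * b := by
  classical
  obtain ⟨D, hD, hcost⟩ := netContent_lt_iff.1 h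
  let W (c : ℕ × (ι → ℤ)) : Set (EuclideanSpace ℝ ι) :=
    ⋃ x ∈ {x | dyadicIndex c.1 x = c.2}, Metric.eball x (2⁻¹ ^ c.1)
  have hW c : netContent dyadicIndex w (W c) ≤ 3 ^ Fintype.card ι * w c.1 := by
    have hmaps : MapsTo (dyadicIndex c.1) (W c) (Finset.Icc (c.2 - 1) (c.2 + 1)) := by
      intro y hy
      obtain ⟨x, hx, hyx⟩ := mem_iUnion₂.1 hy
      rw [← show dyadicIndex c.1 x = c.2 from hx]
      exact dyadicIndex_mem_Icc hyx
    simpa [card_Icc_sub_one_add_one] using netContent_le_card_mul (w := w) hmaps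
  refine ⟨⋃ c : D, W c, isOpen_iUnion fun c => isOpen_biUnion fun x _ => Metric.isOpen_eball,
    fun x hx => ?_, ?_⟩
  · obtain ⟨k, hk⟩ := hD x hx
    exact mem_iUnion.2 ⟨⟨_, hk⟩, mem_iUnion₂.2 ⟨x, rfl,
      Metric.mem_eball_self (ENNReal.pow_pos (by simp) k)⟩⟩
  · calc netContent dyadicIndex w (⋃ c : D, W c)
        ≤ ∑' c : D, netContent dyadicIndex w (W c) := measure_iUnion_le _
      _ ≤ ∑' c : D, 3 ^ Fintype.card ι * w c.1.1 := ENNReal.tsum_le_tsum fun c => hW c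
      _ = 3 ^ Fintype.card ι * cellCost w D := ENNReal.tsum_mul_left
      _ ≤ 3 ^ Fintype.card ι * b := by gcongr

theorem exists_isCompact_netContent_dyadicIndex_ne_zero [Finite ι] {w : ℕ → ℝ≥0∞}
    {B : Set (EuclideanSpace ℝ ι)} (hB : AnalyticSet B) (h : netContent dyadicIndex w B ≠ 0) :
    ∃ K ⊆ B, IsCompact K ∧ netContent dyadicIndex w K ≠ 0 := by
  have := Fintype.ofFinite ι
  obtain ⟨c, hc0, hc⟩ := exists_between (pos_iff_ne_zero.2 h)
  obtain ⟨K, hKB, hK, hKV⟩ := exists_isCompact_forall_isOpen_lt_of_analyticSet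
    (fun _ _ => measure_mono (μ := netContent dyadicIndex w))
    (fun _ => netContent_iUnion_le_iSup (isNet_of_comp_eq parentIndex_dyadicIndex_succ)) hB hc
  refine ⟨K, hKB, hK, fun hK0 => ?_⟩
  have h3 : (3 ^ Fintype.card ι : ℝ≥0∞) ≠ ∞ := ENNReal.pow_ne_top (by simp)
  obtain ⟨V, hV, hKsub, hle⟩ := exists_isOpen_netContent_dyadicIndex_le
    (hK0.trans_lt (ENNReal.div_pos hc0.ne' h3))
  rw [ENNReal.mul_div_cancel (by simp) h3] at hle
  exact (hKV V hV hKsub).not_ge hle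

theorem netContent_comp_subtype_val {X J : Type*} {q : ℕ → X → J} {w : ℕ → ℝ≥0∞} {K : Set X} :
    netContent (fun k (x : K) => q k x) w univ = netContent q w K := by
  simp [netContent_apply, CellCover]

theorem exists_frostman_measure_of_analyticSet [Fintype ι] {t : ℝ} (ht : 0 < t)
    {B : Set (EuclideanSpace ℝ ι)} (hB : AnalyticSet B) (h : μH[t] B ≠ 0) :
    ∃ μ : Measure (EuclideanSpace ℝ ι), IsProbabilityMeasure μ ∧
      (∃ K ⊆ B, IsCompact K ∧ μ K = 1) ∧
      ∃ C ≠ ∞, ∀ x (k : ℕ), μ (Metric.eball x (2⁻¹ ^ k)) ≤ C * (2⁻¹ ^ k) ^ t := by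
  classical
  obtain ⟨κ, hκ⟩ := exists_edist_le_of_dyadicIndex_eq ι
  obtain ⟨K, hKB, hK, hK0⟩ := exists_isCompact_netContent_dyadicIndex_ne_zero hB
    fun h0 => h (hausdorffMeasure_eq_zero_of_netContent_eq_zero hκ ht h0)
  have : CompactSpace K := isCompact_iff_compactSpace.1 hK
  obtain ⟨μ, C, hC, hμ⟩ := exists_probabilityMeasure_le_of_netContent_ne_zero
    (q := fun k (x : K) => dyadicIndex k (x : EuclideanSpace ℝ ι)) (dyadicWeight_ne_top ht.le)
    (par := parentIndex) (fun k x => parentIndex_dyadicIndex_succ k (x : EuclideanSpace ℝ ι))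
    finite_parentIndex_preimage
    (netContent_comp_subtype_val.trans_ne hK0)
  refine ⟨(μ : Measure K).map (↑), Measure.isProbabilityMeasure_map (by fun_prop),
    ⟨K, hKB, hK, ?_⟩, 3 ^ Fintype.card ι * C,
    ENNReal.mul_ne_top (ENNReal.pow_ne_top (by simp)) hC, fun x k => ?_⟩
  · rw [Measure.map_apply measurable_subtype_coe hK.measurableSet]
    simp
  · rw [Measure.map_apply measurable_subtype_coe Metric.isOpen_eball.measurableSet]
    refine (hμ k _ _ (Metric.isOpen_eball.preimage continuous_subtype_val)
      fun y hy => dyadicIndex_mem_Icc hy).trans_eq ?_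
    rw [card_Icc_sub_one_add_one, dyadicWeight]
    push_cast
    ring

end Dyadic

section Energy

theorem inv_rpow_le_one_add_tsum (x : ℝ≥0∞) {s : ℝ} (hs : 0 ≤ s) :
    (x ^ s)⁻¹ ≤ 1 + ∑' k : ℕ, {y | y < 2⁻¹ ^ k}.indicator
      (fun _ => (dyadicWeight s (k + 1))⁻¹) x := by
  classical
  by_cases hex : ∃ k : ℕ, 2⁻¹ ^ k ≤ x
  · have hlow := Nat.find_spec hex
    have hup k (hk : k < Nat.find hex) : x < 2⁻¹ ^ k := not_le.1 (Nat.find_min hex hk)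
    have hinv : (x ^ s)⁻¹ ≤ (dyadicWeight s (Nat.find hex))⁻¹ :=
      ENNReal.inv_le_inv.2 (ENNReal.rpow_le_rpow hlow hs)
    rcases hj : Nat.find hex with - | j
    · rw [hj] at hinv
      exact (hinv.trans_eq (by simp [dyadicWeight])).trans le_self_add
    · rw [hj] at hinv hup
      calc (x ^ s)⁻¹ ≤ (dyadicWeight s (j + 1))⁻¹ := hinv
        _ = {y | y < 2⁻¹ ^ j}.indicator (fun _ => (dyadicWeight s (j + 1))⁻¹) x := by
          rw [indicator_of_mem (s := {y : ℝ≥0∞ | y < 2⁻¹ ^ j}) (hup j j.lt_succ_self)]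
        _ ≤ ∑' k : ℕ, {y | y < 2⁻¹ ^ k}.indicator (fun _ => (dyadicWeight s (k + 1))⁻¹) x :=
          ENNReal.le_tsum j
        _ ≤ _ := le_add_self
  · push Not at hex
    suffices htop : ∑' k : ℕ, {y | y < 2⁻¹ ^ k}.indicator
        (fun _ => (dyadicWeight s (k + 1))⁻¹) x = ∞ by simp [htop]
    rw [eq_top_iff, ← ENNReal.tsum_const_eq_top_of_ne_zero (α := ℕ) one_ne_zero]
    gcongr with k
    rw [indicator_of_mem (s := {y : ℝ≥0∞ | y < 2⁻¹ ^ k}) (hex k)]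
    exact ENNReal.one_le_inv.2
      (ENNReal.rpow_le_one (pow_le_one₀ zero_le (ENNReal.inv_le_one.2 one_le_two)) hs)

theorem tsum_inv_dyadicWeight_mul_dyadicWeight_ne_top {s t : ℝ} (hst : s < t) :
    ∑' k, (dyadicWeight s (k + 1))⁻¹ * dyadicWeight t k ≠ ∞ := by
  have hterm (k : ℕ) : (dyadicWeight s (k + 1))⁻¹ * dyadicWeight t k =
      2⁻¹ ^ (-s) * (2⁻¹ ^ (t - s)) ^ k := by
    simp only [dyadicWeight, ← ENNReal.rpow_natCast, ← ENNReal.rpow_mul, ← ENNReal.rpow_neg]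
    rw [← ENNReal.rpow_add _ _ (by simp) (by simp), ← ENNReal.rpow_add _ _ (by simp) (by simp)]
    congr 1
    push_cast
    ring
  have hratio : (2⁻¹ : ℝ≥0∞) ^ (t - s) < 1 :=
    ENNReal.rpow_lt_one (ENNReal.inv_lt_one.2 ENNReal.one_lt_two) (sub_pos.2 hst)
  rw [tsum_congr hterm, ENNReal.tsum_mul_left, ENNReal.tsum_geometric]
  exact ENNReal.mul_ne_top (by simp) (ENNReal.inv_ne_top.2 (tsub_pos_of_lt hratio).ne')

theorem exists_lintegral_inv_rpow_le {α : Type*} [MeasurableSpace α] (μ : Measure α)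
    [IsFiniteMeasure μ] {s t : ℝ} (hs : 0 ≤ s) (hst : s < t) {C : ℝ≥0∞} (hC : C ≠ ∞) :
    ∃ D ≠ ∞, ∀ h : α → ℝ≥0∞, AEMeasurable h μ →
      (∀ k : ℕ, μ {a | h a < 2⁻¹ ^ k} ≤ C * (2⁻¹ ^ k) ^ t) → ∫⁻ a, (h a ^ s)⁻¹ ∂μ ≤ D := by
  refine ⟨μ univ + C * ∑' k, (dyadicWeight s (k + 1))⁻¹ * dyadicWeight t k,
    ENNReal.add_ne_top.2 ⟨measure_ne_top μ univ,
      ENNReal.mul_ne_top hC (tsum_inv_dyadicWeight_mul_dyadicWeight_ne_top hst)⟩,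
    fun h hh hbound => ?_⟩
  have hmeas (k : ℕ) : NullMeasurableSet {a | h a < 2⁻¹ ^ k} μ :=
    nullMeasurableSet_lt hh aemeasurable_const
  calc ∫⁻ a, (h a ^ s)⁻¹ ∂μ
      ≤ ∫⁻ a, 1 + ∑' k : ℕ, {a | h a < 2⁻¹ ^ k}.indicator
          (fun _ => (dyadicWeight s (k + 1))⁻¹) a ∂μ :=
        lintegral_mono fun a => inv_rpow_le_one_add_tsum (h a) hs
    _ = μ univ + ∑' k : ℕ, (dyadicWeight s (k + 1))⁻¹ * μ {a | h a < 2⁻¹ ^ k} := by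
        rw [lintegral_add_left measurable_const, lintegral_one,
          lintegral_tsum fun k => aemeasurable_const.indicator₀ (hmeas k)]
        simp only [lintegral_indicator_const₀ (hmeas _)]
    _ ≤ μ univ + ∑' k : ℕ, (dyadicWeight s (k + 1))⁻¹ * (C * dyadicWeight t k) := by
        gcongr with k
        exact hbound k
    _ = _ := by simp only [mul_left_comm _ C, ENNReal.tsum_mul_left]

variable {X Y : Type*} [MeasurableSpace X]

/-- The Riesz potential `∫ |x - y|⁻ˢ dν(y)`, where `0⁻ˢ = ∞` for `s > 0`. -/
noncomputable def rieszPotential [EDist X] (s : ℝ) (ν : Measure X) (x : X) : ℝ≥0∞ :=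
  ∫⁻ y, (edist x y ^ s)⁻¹ ∂ν

/-- The Riesz energy `∬ |x - y|⁻ˢ dν(y) dν(x)`. -/
noncomputable def rieszEnergy [EDist X] (s : ℝ) (ν : Measure X) : ℝ≥0∞ :=
  ∫⁻ x, rieszPotential s ν x ∂ν

theorem measure_setOf_edist_le_le_rieszPotential_mul [PseudoEMetricSpace X] [OpensMeasurableSpace X]
    {ν : Measure X} {s : ℝ} (hs : 0 ≤ s) {x : X} (hx : rieszPotential s ν x ≠ ∞) {r : ℝ≥0∞}
    (hr : r ≠ ∞) : ν {y | edist x y ≤ r} ≤ rieszPotential s ν x * r ^ s := by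
  have hmarkov : (r ^ s)⁻¹ * ν {y | edist x y ≤ r} ≤ rieszPotential s ν x := by
    refine le_trans ?_ (mul_meas_ge_le_lintegral (f := fun y => (edist x y ^ s)⁻¹)
      (by fun_prop) (r ^ s)⁻¹)
    exact mul_le_mul_right (measure_mono fun y hy =>
      ENNReal.inv_le_inv.2 (ENNReal.rpow_le_rpow hy hs)) _
  rcases eq_or_ne (r ^ s) 0 with h0 | h0
  · rw [h0, ENNReal.inv_zero] at hmarkov
    by_contra! hpos
    exact hx (top_le_iff.1 ((ENNReal.top_mul (pos_of_gt hpos).ne').symm.trans_le hmarkov))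
  · rw [mul_comm]
    exact (ENNReal.inv_mul_le_iff h0 (ENNReal.rpow_ne_top_of_nonneg hs hr)).1 hmarkov

theorem measurable_rieszPotential [PseudoEMetricSpace X] [SecondCountableTopology X]
    [OpensMeasurableSpace X] (s : ℝ) (ν : Measure X) [SFinite ν] :
    Measurable (rieszPotential s ν) :=
  Measurable.lintegral_prod_right' (f := fun p : X × X => (edist p.1 p.2 ^ s)⁻¹)
    (measurable_edist.pow_const s).inv

theorem le_dimH_of_rieszEnergy_ne_top [EMetricSpace X] [SecondCountableTopology X] [BorelSpace X]
    {ν : Measure X} [SFinite ν] {s : ℝ≥0} (hν : rieszEnergy s ν ≠ ∞) {S : Set X}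
    (hS : ν S ≠ 0) : s ≤ dimH S := by
  have hpot := measurable_rieszPotential (s : ℝ) ν
  obtain ⟨n, hn⟩ : ∃ n : ℕ, ν (S ∩ {x | rieszPotential s ν x ≤ n}) ≠ 0 := by
    by_contra! h
    refine hS (measure_mono_null (fun x hx => ?_) (measure_union_null (measure_iUnion_null h)
      (ae_iff.1 (ae_lt_top hpot hν))))
    by_cases hx' : rieszPotential s ν x < ∞
    · obtain ⟨n, hn⟩ := ENNReal.exists_nat_gt hx'.ne
      exact .inl (mem_iUnion.2 ⟨n, hx, hn.le⟩)
    · exact .inr hx'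
  let A := {x | rieszPotential s ν x ≤ n}
  have hA : MeasurableSet A := measurableSet_le hpot measurable_const
  let ν' : Measure X := ((n : ℝ≥0∞) + 1)⁻¹ • ν.restrict A
  have hν' : ν' ≤ μH[(s : ℝ)] := by
    refine Measure.le_hausdorffMeasure s ν' 1 one_pos fun G hG => ?_
    simp only [ν', Measure.smul_apply, smul_eq_mul, Measure.restrict_apply' hA]
    rw [ENNReal.inv_mul_le_iff (by simp) (by simp)]
    rcases (G ∩ A).eq_empty_or_nonempty with h | ⟨x, hxG, hxA⟩
    · simp [h]
    calc ν (G ∩ A) ≤ ν {y | edist x y ≤ Metric.ediam G} :=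
          measure_mono fun y hy => Metric.edist_le_ediam_of_mem hxG hy.1
      _ ≤ rieszPotential s ν x * Metric.ediam G ^ (s : ℝ) :=
          measure_setOf_edist_le_le_rieszPotential_mul s.2
            (ne_top_of_le_ne_top (ENNReal.natCast_ne_top n) hxA)
            (ne_top_of_le_ne_top ENNReal.one_ne_top hG)
      _ ≤ (n + 1) * Metric.ediam G ^ (s : ℝ) := by
          gcongr
          exact le_add_right hxA
  refine le_dimH_of_hausdorffMeasure_ne_zero (ne_bot_of_le_ne_bot ?_ (hν' S))
  simpa [ν', Measure.restrict_apply' hA, ENNReal.add_eq_top] using hn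

theorem rieszEnergy_map [PseudoEMetricSpace Y] [SecondCountableTopology Y] [MeasurableSpace Y]
    [OpensMeasurableSpace Y] {μ : Measure X} [SFinite μ] {T : X → Y} (hT : Measurable T) (s : ℝ) :
    rieszEnergy s (μ.map T) = ∫⁻ p, (edist (T p.1) (T p.2) ^ s)⁻¹ ∂μ.prod μ := by
  rw [rieszEnergy, lintegral_map (measurable_rieszPotential s _) hT,
    lintegral_prod _ (by fun_prop)]
  refine lintegral_congr fun x => ?_
  rw [rieszPotential, lintegral_map (by fun_prop) hT]

end Energy

section Transversality

variable {Θ : Type*} [MeasurableSpace Θ] {E : Type*} [NormedAddCommGroup E] [NormedSpace ℝ E]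
  {F : Type*} [NormedAddCommGroup F] [NormedSpace ℝ F]

/-- The family of linear maps `T θ` is transversal of order `p` with respect to `lam`: a fixed
direction is contracted by a factor `δ` only on a set of parameters of measure `O(δᵖ)`. -/
def IsTransversal (lam : Measure Θ) (T : Θ → E →L[ℝ] F) (p : ℝ) : Prop :=
  ∃ C ≠ ∞, ∀ e : E, ‖e‖ = 1 → ∀ δ : ℝ, 0 < δ → δ ≤ 1 →
    lam {θ | ‖T θ e‖ < δ} ≤ C * ENNReal.ofReal δ ^ p

variable {lam : Measure Θ} {T : Θ → E →L[ℝ] F} {s p : ℝ}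

theorem IsTransversal.mono_measure {lam' : Measure Θ} (hT : IsTransversal lam T p)
    (h : lam' ≤ lam) : IsTransversal lam' T p :=
  let ⟨C, hC, hbound⟩ := hT
  ⟨C, hC, fun e he δ hδ hδ1 => (h _).trans (hbound e he δ hδ hδ1)⟩

theorem lintegral_inv_rpow_enorm_apply_le (hs : 0 < s) {D : ℝ≥0∞} (hD : D ≠ 0)
    (h : ∀ e, ‖e‖ = 1 → ∫⁻ θ, (‖T θ e‖ₑ ^ s)⁻¹ ∂lam ≤ D) (z : E) :
    ∫⁻ θ, (‖T θ z‖ₑ ^ s)⁻¹ ∂lam ≤ D * (‖z‖ₑ ^ s)⁻¹ := by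
  rcases eq_or_ne z 0 with rfl | hz
  · simp [hs, ENNReal.mul_top hD]
  let e := ‖z‖⁻¹ • z
  have hz_eq : z = ‖z‖ • e := (smul_inv_smul₀ (norm_ne_zero_iff.2 hz) z).symm
  have h0 : ‖z‖ₑ ^ s ≠ 0 := by simp [ENNReal.rpow_eq_zero_iff, hz, hs.not_gt]
  have htop : ‖z‖ₑ ^ s ≠ ∞ := ENNReal.rpow_ne_top_of_nonneg hs.le (by simp)
  have hhom θ : (‖T θ z‖ₑ ^ s)⁻¹ = (‖z‖ₑ ^ s)⁻¹ * (‖T θ e‖ₑ ^ s)⁻¹ := by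
    conv_lhs => rw [hz_eq]
    rw [map_smul, enorm_smul, enorm_norm, ENNReal.mul_rpow_of_nonneg _ _ hs.le,
      ENNReal.mul_inv (.inl h0) (.inl htop)]
  simp only [hhom]
  rw [lintegral_const_mul' _ _ (ENNReal.inv_ne_top.2 h0), mul_comm]
  gcongr
  exact h e (norm_smul_inv_norm (𝕜 := ℝ) hz)

theorem IsTransversal.exists_lintegral_inv_rpow_le [IsFiniteMeasure lam] [MeasurableSpace E]
    [OpensMeasurableSpace E] [MeasurableSpace F] [BorelSpace F] [SecondCountableTopology F]
    (hT : IsTransversal lam T p) (hT_meas : AEMeasurable T lam) (hs : 0 ≤ s) (hsp : s < p) :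
    ∃ D ≠ ∞, ∀ e, ‖e‖ = 1 → ∫⁻ θ, (‖T θ e‖ₑ ^ s)⁻¹ ∂lam ≤ D := by
  obtain ⟨C, hC, hbound⟩ := hT
  obtain ⟨D, hD, hint⟩ := _root_.exists_lintegral_inv_rpow_le lam hs hsp hC
  refine ⟨D, hD, fun e he => hint _ (hT_meas.apply_continuousLinearMap e).enorm fun k => ?_⟩
  simp only [inv_two_pow_eq_ofReal]
  refine (measure_mono fun θ hθ => ?_).trans
    (hbound e he (2 ^ k)⁻¹ (by positivity) (inv_le_one_of_one_le₀ (one_le_pow₀ one_le_two)))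
  rwa [mem_ofPred_eq, ← ofReal_norm, ENNReal.ofReal_lt_ofReal_iff (by positivity)] at hθ

variable [MeasurableSpace F] [BorelSpace F] [SecondCountableTopology F]

theorem ae_rieszEnergy_map_ne_top [SecondCountableTopology E] [MeasurableSpace E] [BorelSpace E]
    [SFinite lam] (hT : AEMeasurable T lam) (hs : 0 < s) {D : ℝ≥0∞} (hD : D ≠ ∞)
    (hdir : ∀ e, ‖e‖ = 1 → ∫⁻ θ, (‖T θ e‖ₑ ^ s)⁻¹ ∂lam ≤ D) {μ : Measure E} [SFinite μ]
    (hμ : rieszEnergy s μ ≠ ∞) : ∀ᵐ θ ∂lam, rieszEnergy s (μ.map (T θ)) ≠ ∞ := by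
  let g (θ : Θ) (z : E × E) : ℝ≥0∞ := (‖T θ (z.1 - z.2)‖ₑ ^ s)⁻¹
  have hg : AEMeasurable (Function.uncurry g) (lam.prod (μ.prod μ)) := by
    have hsub : AEMeasurable (fun a : Θ × E × E => a.2.1 - a.2.2) (lam.prod (μ.prod μ)) := by
      fun_prop
    exact ((ContinuousLinearMap.measurable_apply₂.comp_aemeasurable
      (hT.comp_fst.prodMk hsub)).enorm.pow_const s).inv
  have henergy θ : rieszEnergy s (μ.map (T θ)) = ∫⁻ z, g θ z ∂μ.prod μ := by
    simp only [rieszEnergy_map (T θ).continuous.measurable, g, edist_eq_enorm_sub, map_sub]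
  have hbound : ∫⁻ θ, ∫⁻ z, g θ z ∂μ.prod μ ∂lam ≤ (1 + D) * rieszEnergy s μ :=
    calc ∫⁻ θ, ∫⁻ z, g θ z ∂μ.prod μ ∂lam
        = ∫⁻ z, ∫⁻ θ, g θ z ∂lam ∂μ.prod μ := lintegral_lintegral_swap hg
      _ ≤ ∫⁻ z, (1 + D) * (‖z.1 - z.2‖ₑ ^ s)⁻¹ ∂μ.prod μ :=
        lintegral_mono fun z => lintegral_inv_rpow_enorm_apply_le hs (by simp)
          (fun e he => (hdir e he).trans le_add_self) (z.1 - z.2)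
      _ = (1 + D) * rieszEnergy s μ := by
        rw [lintegral_const_mul _ (by fun_prop), lintegral_prod _ (by fun_prop)]
        simp only [rieszEnergy, rieszPotential, edist_eq_enorm_sub]
  have hfinite : (1 + D) * rieszEnergy s μ ≠ ∞ :=
    ENNReal.mul_ne_top (ENNReal.add_ne_top.2 ⟨ENNReal.one_ne_top, hD⟩) hμ
  filter_upwards [ae_lt_top' hg.lintegral_prod_right' (ne_top_of_le_ne_top hfinite hbound)]
    with θ hθ
  rw [henergy]
  exact hθ.ne

variable {ι : Type*} [Fintype ι] {B : Set (EuclideanSpace ℝ ι)}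

theorem exists_rieszEnergy_ne_top_of_lt_dimH (hB : AnalyticSet B) {s : ℝ≥0}
    (hs : s < dimH B) : ∃ μ : Measure (EuclideanSpace ℝ ι), IsProbabilityMeasure μ ∧ μ B ≠ 0 ∧
      rieszEnergy s μ ≠ ∞ := by
  obtain ⟨t, hst, htB⟩ := ENNReal.lt_iff_exists_nnreal_btwn.1 hs
  have hst' : s < t := by exact_mod_cast hst
  have ht : μH[(t : ℝ)] B ≠ 0 := by simp [hausdorffMeasure_of_lt_dimH htB]
  obtain ⟨μ, hμ, ⟨K, hKB, -, hK⟩, C, hC, hball⟩ :=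
    exists_frostman_measure_of_analyticSet (NNReal.coe_pos.2 (pos_of_gt hst')) hB ht
  obtain ⟨D, hD, hpot⟩ := exists_lintegral_inv_rpow_le μ s.2 (NNReal.coe_lt_coe.2 hst') hC
  refine ⟨μ, hμ, (one_pos.trans_le (hK.ge.trans (measure_mono hKB))).ne', ?_⟩
  refine ne_top_of_le_ne_top hD ((lintegral_mono (g := fun _ => D) fun x => ?_).trans_eq (by simp))
  refine hpot _ (by fun_prop) fun k => ?_
  simpa only [Metric.eball, edist_comm x] using hball x k

theorem ae_dimH_le_dimH_image_of_isTransversal {lam : Measure Θ} [IsFiniteMeasure lam]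
    {T : Θ → EuclideanSpace ℝ ι →L[ℝ] F} (hT_meas : AEMeasurable T lam) {p : ℝ≥0}
    (hT : IsTransversal lam T p) (hB : AnalyticSet B) (hBp : dimH B ≤ p) :
    ∀ᵐ θ ∂lam, dimH B ≤ dimH (T θ '' B) := by
  have hlt (s : ℝ≥0) (hs : (s : ℝ≥0∞) ∈ Ioo 0 (dimH B)) : ∀ᵐ θ ∂lam, s ≤ dimH (T θ '' B) := by
    have hs0 : (0 : ℝ) < s := by exact_mod_cast hs.1
    have hsp : (s : ℝ) < p := by exact_mod_cast hs.2.trans_le hBp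
    obtain ⟨μ, hμ, hμB, henergy⟩ := exists_rieszEnergy_ne_top_of_lt_dimH hB hs.2
    obtain ⟨D, hD, hdir⟩ := hT.exists_lintegral_inv_rpow_le hT_meas hs0.le hsp
    filter_upwards [ae_rieszEnergy_map_ne_top hT_meas hs0 hD hdir henergy] with θ hθ
    refine le_dimH_of_rieszEnergy_ne_top hθ (ne_bot_of_le_ne_bot hμB ?_)
    exact (measure_mono (subset_preimage_image _ B)).trans
      (Measure.le_map_apply (T θ).continuous.aemeasurable _)
  rcases eq_or_ne (dimH B) 0 with h0 | h0
  · simp [h0]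
  obtain ⟨u, -, hu, hlim⟩ := exists_seq_strictMono_tendsto' (pos_iff_ne_zero.2 h0)
  lift u to ℕ → ℝ≥0 using fun n => (hu n).2.ne_top
  filter_upwards [ae_all_iff.2 fun n => hlt (u n) (hu n)] with θ hθ using le_of_tendsto' hlim hθ

end Transversality

section Sublevel

theorem volume_dist_le_le_ofReal {X : Type*} [PseudoMetricSpace X] {g : ℝ → X} {I : Set ℝ} {K : ℝ}
    (hK : 0 ≤ K) (hg : ∀ x ∈ I, ∀ y ∈ I, dist x y ≤ K * dist (g x) (g y)) (a : X) (δ : ℝ) :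
    volume {x | x ∈ I ∧ dist (g x) a ≤ δ} ≤ ENNReal.ofReal (K * (2 * δ)) := by
  refine (Real.volume_le_diam _).trans (Metric.ediam_le_of_forall_dist_le fun x hx y hy => ?_)
  have htriangle : dist (g x) (g y) ≤ 2 * δ := by
    linarith [dist_triangle_right (g x) (g y) a, hx.2, hy.2]
  exact (hg x hx.1 y hy.1).trans (mul_le_mul_of_nonneg_left htriangle hK)

variable {I : Set ℝ} {f f' f'' : ℝ → ℝ} {c d : ℝ}

theorem mul_sub_le_sub_of_le_hasDerivWithinAt (hI : Convex ℝ I)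
    (hf : ∀ x ∈ I, HasDerivWithinAt f (f' x) I x) (hc : ∀ x ∈ I, c ≤ f' x) :
    ∀ x ∈ I, ∀ y ∈ I, x ≤ y → c * (y - x) ≤ f y - f x := by
  have hderiv x (hx : x ∈ interior I) : HasDerivAt f (f' x) x :=
    (hf x (interior_subset hx)).hasDerivAt (mem_interior_iff_mem_nhds.1 hx)
  exact hI.mul_sub_le_image_sub_of_le_deriv (fun x hx => (hf x hx).continuousWithinAt)
    (fun x hx => (hderiv x hx).differentiableAt.differentiableWithinAt)
    fun x hx => (hderiv x hx).deriv ▸ hc x (interior_subset hx)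

theorem volume_abs_lt_le_of_le_deriv (hI : Convex ℝ I) (hc : 0 < c)
    (hf : ∀ x ∈ I, HasDerivWithinAt f (f' x) I x) (hfc : ∀ x ∈ I, c ≤ f' x) (δ : ℝ) :
    volume {x | x ∈ I ∧ |f x| < δ} ≤ ENNReal.ofReal (c⁻¹ * (2 * δ)) := by
  have hexpand : ∀ x ∈ I, ∀ y ∈ I, dist x y ≤ c⁻¹ * dist (f x) (f y) := by
    intro x hx y hy
    wlog hxy : x ≤ y generalizing x y
    · simpa only [dist_comm] using this y hy x hx (le_of_not_ge hxy)
    rw [le_inv_mul_iff₀ hc, dist_comm x, dist_comm (f x), Real.dist_eq, Real.dist_eq,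
      abs_of_nonneg (sub_nonneg.2 hxy)]
    exact (mul_sub_le_sub_of_le_hasDerivWithinAt hI hf hfc x hx y hy hxy).trans (le_abs_self _)
  refine (measure_mono fun x hx => ?_).trans
    (volume_dist_le_le_ofReal (inv_nonneg.2 hc.le) hexpand 0 δ)
  exact ⟨hx.1, (dist_zero_right (f x)).trans_le hx.2.le⟩

theorem volume_abs_lt_le_of_le_deriv_deriv (hI : Convex ℝ I) (hc : 0 < c) (hd : 0 < d)
    (hf : ∀ x ∈ I, HasDerivWithinAt f (f' x) I x)
    (hf' : ∀ x ∈ I, HasDerivWithinAt f' (f'' x) I x) (hfc : ∀ x ∈ I, c ≤ f'' x) :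
    volume {x | x ∈ I ∧ |f x| < c * d ^ 2} ≤ 6 * ENNReal.ofReal d := by
  have hcd : 0 < c * d := mul_pos hc hd
  have hmono : MonotoneOn f' I := fun x hx y hy hxy => sub_nonneg.1 <|
    (mul_nonneg hc.le (sub_nonneg.2 hxy)).trans
      (mul_sub_le_sub_of_le_hasDerivWithinAt hI hf' hfc x hx y hy hxy)
  let P := {x | x ∈ I ∧ c * d ≤ f' x}
  let N := {x | x ∈ I ∧ f' x ≤ -(c * d)}
  have hP : volume {x | x ∈ P ∧ |f x| < c * d ^ 2} ≤ ENNReal.ofReal (2 * d) := by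
    refine (volume_abs_lt_le_of_le_deriv (hmono.convex_ge hI _) hcd
      (fun x hx => (hf x hx.1).mono fun y hy => hy.1) (fun x hx => hx.2) _).trans_eq ?_
    congr 1
    field_simp
  have hN : volume {x | x ∈ N ∧ |f x| < c * d ^ 2} ≤ ENNReal.ofReal (2 * d) := by
    simp only [← abs_neg (f _)]
    refine (volume_abs_lt_le_of_le_deriv (hmono.convex_le hI _) hcd
      (fun x hx => (hf x hx.1).neg.mono fun y hy => hy.1)
      (fun x hx => le_neg.2 hx.2) _).trans_eq ?_
    congr 1
    field_simp
  have hZ : volume {x | x ∈ I ∧ |f' x| < c * d} ≤ ENNReal.ofReal (2 * d) := by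
    refine (volume_abs_lt_le_of_le_deriv hI hc hf' hfc _).trans_eq ?_
    congr 1
    field_simp
  have hcover : {x | x ∈ I ∧ |f x| < c * d ^ 2} ⊆ {x | x ∈ P ∧ |f x| < c * d ^ 2} ∪
      {x | x ∈ N ∧ |f x| < c * d ^ 2} ∪ {x | x ∈ I ∧ |f' x| < c * d} := by
    rintro x ⟨hxI, hx⟩
    rcases lt_or_ge |f' x| (c * d) with h | h
    · exact .inr ⟨hxI, h⟩
    rcases le_abs.1 h with h | h
    · exact .inl (.inl ⟨⟨hxI, h⟩, hx⟩)
    · exact .inl (.inr ⟨⟨hxI, le_neg.1 h⟩, hx⟩)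
  calc volume {x | x ∈ I ∧ |f x| < c * d ^ 2}
      ≤ ENNReal.ofReal (2 * d) + ENNReal.ofReal (2 * d) + ENNReal.ofReal (2 * d) :=
        (measure_mono hcover).trans ((measure_union_le _ _).trans
          (add_le_add ((measure_union_le _ _).trans (add_le_add hP hN)) hZ))
    _ = 6 * ENNReal.ofReal d := by
        rw [ENNReal.ofReal_mul zero_le_two, ENNReal.ofReal_ofNat]
        ring

theorem volume_abs_lt_le_of_le_jet (hI : Convex ℝ I) (hc : 0 < c) (hd : 0 < d)
    (hf : ∀ x ∈ I, HasDerivWithinAt f (f' x) I x)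
    (hf' : ∀ x ∈ I, HasDerivWithinAt f' (f'' x) I x)
    (hjet : (∀ x ∈ I, c ≤ f x) ∨ (∀ x ∈ I, c ≤ f' x) ∨ ∀ x ∈ I, c ≤ f'' x) :
    volume {x | x ∈ I ∧ |f x| < c * d ^ 2} ≤ (volume I + 6) * ENNReal.ofReal d := by
  rcases le_or_gt 1 d with h1 | h1
  · calc volume {x | x ∈ I ∧ |f x| < c * d ^ 2} ≤ volume I := measure_mono fun x hx => hx.1
      _ ≤ (volume I + 6) * 1 := le_self_add.trans_eq (mul_one _).symm
      _ ≤ (volume I + 6) * ENNReal.ofReal d := by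
        gcongr
        exact ENNReal.one_le_ofReal.2 h1
  have hd2 : d ^ 2 ≤ d := pow_le_of_le_one hd.le h1.le two_ne_zero
  suffices h : volume {x | x ∈ I ∧ |f x| < c * d ^ 2} ≤ 6 * ENNReal.ofReal d from
    h.trans (mul_le_mul_left le_add_self _)
  rcases hjet with h | h | h
  · have hempty : {x | x ∈ I ∧ |f x| < c * d ^ 2} = ∅ := by
      refine eq_empty_of_forall_notMem fun x ⟨hxI, hx⟩ => ?_
      have hcd : c * d ^ 2 ≤ c := mul_le_of_le_one_right hc.le (hd2.trans h1.le)
      exact (hx.trans_le (hcd.trans ((h x hxI).trans (le_abs_self _)))).false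
    simp [hempty]
  · refine (volume_abs_lt_le_of_le_deriv hI hc hf h _).trans ?_
    rw [← ENNReal.ofReal_ofNat, ← ENNReal.ofReal_mul (by norm_num)]
    refine ENNReal.ofReal_le_ofReal ?_
    calc c⁻¹ * (2 * (c * d ^ 2)) = 2 * d ^ 2 := by field_simp
      _ ≤ 6 * d := by linarith
  · exact volume_abs_lt_le_of_le_deriv_deriv hI hc hd hf hf' h

end Sublevel

section Localisation

theorem ae_restrict_of_forall_exists_nhdsWithin {α : Type*} [TopologicalSpace α]
    [SecondCountableTopology α] [MeasurableSpace α] {μ : Measure α} {U : Set α} {P : α → Prop}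
    (h : ∀ x ∈ U, ∃ W ∈ 𝓝[U] x, ∀ᵐ y ∂μ.restrict W, P y) : ∀ᵐ y ∂μ.restrict U, P y := by
  choose! W hW hP using h
  obtain ⟨t, htU, ht, hUW⟩ := TopologicalSpace.countable_cover_nhdsWithin hW
  exact ae_mono (Measure.restrict_mono_set μ hUW)
    ((ae_restrict_biUnion_iff W ht P).2 fun x hx => hP x (htU hx))

theorem ae_restrict_dimH_image_eq_of_isTransversal {ι : Type*} [Fintype ι] {F : Type*}
    [NormedAddCommGroup F] [NormedSpace ℝ F] [SecondCountableTopology F] {U : Set ℝ}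
    (hU : IsOpen U) {T : ℝ → EuclideanSpace ℝ ι →L[ℝ] F} (hT_cont : ContinuousOn T U) {p : ℝ≥0}
    (hT : ∀ θ₀ ∈ U, ∃ W ∈ 𝓝 θ₀, IsTransversal (volume.restrict W) T p)
    {B : Set (EuclideanSpace ℝ ι)} (hB : AnalyticSet B) (hBp : dimH B ≤ p) :
    ∀ᵐ θ ∂volume.restrict U, dimH (T θ '' B) = dimH B := by
  borelize F
  refine ae_restrict_of_forall_exists_nhdsWithin fun θ₀ hθ₀ => ?_
  obtain ⟨W, hW, hTW⟩ := hT θ₀ hθ₀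
  obtain ⟨r, hr, hball⟩ := Metric.mem_nhds_iff.1 (inter_mem hW (hU.mem_nhds hθ₀))
  have : IsFiniteMeasure (volume.restrict (Metric.ball θ₀ r)) :=
    isFiniteMeasure_restrict.2 measure_ball_lt_top.ne
  refine ⟨Metric.ball θ₀ r, mem_nhdsWithin_of_mem_nhds (Metric.ball_mem_nhds θ₀ hr), ?_⟩
  have hT_meas : AEMeasurable T (volume.restrict (Metric.ball θ₀ r)) :=
    (hT_cont.mono fun θ hθ => (hball hθ).2).aemeasurable measurableSet_ball
  have hT_ball : IsTransversal (volume.restrict (Metric.ball θ₀ r)) T p :=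
    hTW.mono_measure (Measure.restrict_mono_set _ fun θ hθ => (hball hθ).1)
  filter_upwards [ae_dimH_le_dimH_image_of_isTransversal hT_meas hT_ball hB hBp] with θ hθ
  exact ((T θ).lipschitz.dimH_image_le B).antisymm hθ

end Localisation

section LineProjections

variable {E : Type*} [NormedAddCommGroup E] [InnerProductSpace ℝ E]

theorem exists_pos_forall_exists_le_abs_inner_of_span_eq_top [FiniteDimensional ℝ E] {ι : Type*}
    [Finite ι] {v : ι → E} (hv : Submodule.span ℝ (range v) = ⊤) :
    ∃ c > 0, ∀ e : E, ‖e‖ = 1 → ∃ i, c ≤ |inner ℝ (v i) e| := by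
  have := Fintype.ofFinite ι
  let L : E →ₗ[ℝ] ι → ℝ := LinearMap.pi fun i => innerₛₗ ℝ (v i)
  have hL : L.ker = ⊥ := by
    refine (Submodule.eq_bot_iff _).2 fun e he => ?_
    have hspan : Submodule.span ℝ (range v) ≤ (ℝ ∙ e)ᗮ := by
      rw [Submodule.span_le]
      rintro - ⟨i, rfl⟩
      exact Submodule.mem_orthogonal_singleton_iff_inner_left.2 (congrFun he i)
    rw [hv] at hspan
    exact inner_self_eq_zero.1
      (Submodule.mem_orthogonal_singleton_iff_inner_left.1 (hspan (Submodule.mem_top (x := e))))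
  obtain ⟨K, hK, hanti⟩ := L.exists_antilipschitzWith hL
  have hK' : (0 : ℝ) < (K : ℝ)⁻¹ := inv_pos.2 hK
  refine ⟨(K : ℝ)⁻¹, hK', fun e he => ?_⟩
  by_contra! hlt
  have hnorm : ‖L e‖ < (K : ℝ)⁻¹ := (pi_norm_lt_iff hK').2 hlt
  have hone : 1 ≤ K * ‖L e‖ := he.symm.trans_le (hanti.le_mul_norm (map_zero L) e)
  exact (((inv_le_iff_one_le_mul₀' (NNReal.coe_pos.2 hK)).2 hone).trans_lt hnorm).false

theorem exists_pos_exists_mem_nhds_le_inner [FiniteDimensional ℝ E] {Θ : Type*}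
    [TopologicalSpace Θ] {ι : Type*} [Finite ι] {v : ι → Θ → E} {θ₀ : Θ}
    (hcont : ∀ i, ContinuousAt (v i) θ₀)
    (hspan : Submodule.span ℝ (range fun i => v i θ₀) = ⊤) :
    ∃ c > 0, ∃ W ∈ 𝓝 θ₀, ∀ e : E, ‖e‖ = 1 →
      ∃ i, ∃ e' ∈ ({e, -e} : Set E), ∀ θ ∈ W, c ≤ inner ℝ (v i θ) e' := by
  obtain ⟨c, hc, hlarge⟩ := exists_pos_forall_exists_le_abs_inner_of_span_eq_top hspan
  have hclose : ∀ᶠ θ in 𝓝 θ₀, ∀ i, dist (v i θ) (v i θ₀) < c / 2 :=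
    eventually_all.2 fun i => (hcont i).eventually (Metric.ball_mem_nhds _ (half_pos hc))
  refine ⟨c / 2, half_pos hc, _, hclose, fun e he => ?_⟩
  obtain ⟨i, hi⟩ := hlarge e he
  have hpersist e' (he' : ‖e'‖ = 1) (hle : c ≤ inner ℝ (v i θ₀) e') θ
      (hθ : dist (v i θ) (v i θ₀) < c / 2) : c / 2 ≤ inner ℝ (v i θ) e' := by
    have hdiff : inner ℝ (v i θ₀ - v i θ) e' ≤ dist (v i θ) (v i θ₀) := by
      simpa [he', dist_eq_norm'] using real_inner_le_norm (v i θ₀ - v i θ) e'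
    rw [inner_sub_left] at hdiff
    linarith
  rcases le_abs.1 hi with h | h
  · exact ⟨i, e, by simp, fun θ hθ => hpersist e he h θ (hθ i)⟩
  · refine ⟨i, -e, by simp, fun θ hθ => hpersist (-e) (by rwa [norm_neg]) ?_ θ (hθ i)⟩
    rwa [inner_neg_right]

theorem hasDerivWithinAt_inner_const {γ : ℝ → E} {U I : Set ℝ} (hU : IsOpen U)
    (hγ : DifferentiableOn ℝ γ U) (hIU : I ⊆ U) (e : E) :
    ∀ θ ∈ I, HasDerivWithinAt (fun θ => inner ℝ (γ θ) e) (inner ℝ (deriv γ θ) e) I θ := by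
  intro θ hθ
  have hderiv := (hγ.differentiableAt (hU.mem_nhds (hIU hθ))).hasDerivAt
  simpa using (hderiv.inner ℝ (hasDerivAt_const θ e)).hasDerivWithinAt

theorem exists_isTransversal_innerSL [FiniteDimensional ℝ E] {U : Set ℝ} (hU : IsOpen U)
    {γ : ℝ → E} (hγ : ContDiffOn ℝ 2 γ U) {θ₀ : ℝ} (hθ₀ : θ₀ ∈ U)
    (hspan : Submodule.span ℝ {γ θ₀, deriv γ θ₀, deriv (deriv γ) θ₀} = ⊤) :
    ∃ W ∈ 𝓝 θ₀, IsTransversal (volume.restrict W) (fun θ => innerSL ℝ (γ θ)) (1 / 2) := by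
  have hγ' : ContDiffOn ℝ 1 (deriv γ) U := hγ.deriv_of_isOpen hU (by norm_num)
  have hγ'' : ContinuousOn (deriv (deriv γ)) U := hγ'.continuousOn_deriv_of_isOpen hU le_rfl
  let jet : Fin 3 → ℝ → E := ![γ, deriv γ, deriv (deriv γ)]
  have hcont (i : Fin 3) : ContinuousAt (jet i) θ₀ := by
    fin_cases i
    exacts [hγ.continuousOn.continuousAt (hU.mem_nhds hθ₀),
      hγ'.continuousOn.continuousAt (hU.mem_nhds hθ₀), hγ''.continuousAt (hU.mem_nhds hθ₀)]
  have hrange : range (fun i => jet i θ₀) = {γ θ₀, deriv γ θ₀, deriv (deriv γ) θ₀} := by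
    ext x
    simp only [mem_range, Fin.exists_fin_succ, mem_insert_iff, mem_singleton_iff, eq_comm (a := x)]
    simp [jet]
  obtain ⟨c, hc, W, hW, hjet⟩ := exists_pos_exists_mem_nhds_le_inner hcont (hrange ▸ hspan)
  obtain ⟨r, hr, hball⟩ := Metric.mem_nhds_iff.1 (inter_mem hW (hU.mem_nhds hθ₀))
  set I := Metric.ball θ₀ r
  have hIU : I ⊆ U := fun θ hθ => (hball hθ).2
  have hI_top : volume I + 6 ≠ ∞ := by simp [I, ENNReal.mul_eq_top]
  refine ⟨I, Metric.ball_mem_nhds θ₀ hr, (volume I + 6) * ENNReal.ofReal c⁻¹ ^ (1 / 2 : ℝ),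
    ENNReal.mul_ne_top hI_top (by simp), fun e he δ hδ _ => ?_⟩
  obtain ⟨i, e', he', hle⟩ := hjet e he
  have habs θ : ‖innerSL ℝ (γ θ) e‖ = |inner ℝ (γ θ) e'| := by
    rcases he' with rfl | rfl <;> simp
  have hδ_eq : c * √(δ / c) ^ 2 = δ := by
    rw [Real.sq_sqrt (by positivity), mul_div_cancel₀ _ hc.ne']
  have hderivs : (∀ θ ∈ I, c ≤ inner ℝ (γ θ) e') ∨ (∀ θ ∈ I, c ≤ inner ℝ (deriv γ θ) e') ∨
      ∀ θ ∈ I, c ≤ inner ℝ (deriv (deriv γ) θ) e' := by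
    have hI θ (hθ : θ ∈ I) := hle θ (hball hθ).1
    fin_cases i
    exacts [.inl hI, .inr (.inl hI), .inr (.inr hI)]
  have hsublevel := volume_abs_lt_le_of_le_jet (convex_ball θ₀ r) hc
    (Real.sqrt_pos.2 (div_pos hδ hc))
    (hasDerivWithinAt_inner_const hU (hγ.differentiableOn two_ne_zero) hIU e')
    (hasDerivWithinAt_inner_const hU (hγ'.differentiableOn one_ne_zero) hIU e') hderivs
  rw [hδ_eq] at hsublevel
  simp only [habs, Measure.restrict_apply' (show MeasurableSet I from measurableSet_ball)]
  rw [inter_comm]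
  refine hsublevel.trans_eq ?_
  rw [mul_assoc, ← ENNReal.mul_rpow_of_nonneg _ _ (by norm_num),
    ← ENNReal.ofReal_mul (by positivity), ENNReal.ofReal_rpow_of_nonneg (by positivity)
    (by norm_num), ← Real.sqrt_eq_rpow, inv_mul_eq_div]

end LineProjections

section PlaneProjections

variable {E : Type*} [NormedAddCommGroup E] [InnerProductSpace ℝ E]

theorem starProjection_orthogonal_singleton_eq {u : E} (hu : ‖u‖ = 1) :
    (ℝ ∙ u)ᗮ.starProjection = ContinuousLinearMap.id ℝ E - InnerProductSpace.rankOne ℝ u u := by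
  ext x
  simp [Submodule.starProjection_orthogonal, Submodule.starProjection_unit_singleton ℝ hu]

theorem norm_sub_le_two_mul_norm_starProjection {u e : E} (hu : ‖u‖ = 1) (he : ‖e‖ = 1)
    (h : 0 ≤ inner ℝ u e) : ‖e - u‖ ≤ 2 * ‖(ℝ ∙ u)ᗮ.starProjection e‖ := by
  have hle : inner ℝ u e ≤ 1 := by simpa [hu, he] using real_inner_le_norm u e
  have hproj : ‖(ℝ ∙ u)ᗮ.starProjection e‖ ^ 2 = 1 - inner ℝ u e ^ 2 := by
    rw [starProjection_orthogonal_singleton_eq hu]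
    simp only [sub_apply, ContinuousLinearMap.id_apply,
      InnerProductSpace.rankOne_apply, norm_sub_sq_real, he, norm_smul, hu, inner_smul_right,
      real_inner_comm u e, Real.norm_eq_abs, mul_one, sq_abs]
    ring
  refine (pow_le_pow_iff_left₀ (norm_nonneg _) (by positivity) two_ne_zero).1 ?_
  rw [norm_sub_sq_real, mul_pow, hproj, hu, he, real_inner_comm]
  nlinarith

theorem exists_forall_dist_le_mul_dist {F : Type*} [NormedAddCommGroup F] [NormedSpace ℝ F]
    {γ : ℝ → F} {γ' : F} {θ₀ : ℝ} (hγ : HasStrictDerivAt γ γ' θ₀) (h0 : γ' ≠ 0) :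
    ∃ K > 0, ∃ W ∈ 𝓝 θ₀, ∀ x ∈ W, ∀ y ∈ W, dist x y ≤ K * dist (γ x) (γ y) := by
  obtain ⟨K, hK, hbound⟩ := (HasDerivAtFilter.isTheta_sub hγ h0).isBigO_symm.exists_pos
  have hprod : ∀ᶠ p : ℝ × ℝ in 𝓝 θ₀ ×ˢ 𝓝 θ₀, ‖p.1 - p.2‖ ≤ K * ‖γ p.1 - γ p.2‖ :=
    nhds_prod_eq (x := θ₀) (y := θ₀) ▸ hbound.bound
  obtain ⟨W, hW, hexpand⟩ :=
    (eventually_prod_self_iff (r := fun x y => ‖x - y‖ ≤ K * ‖γ x - γ y‖)).1 hprod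
  exact ⟨K, hK, W, hW, by simpa only [dist_eq_norm] using hexpand⟩

theorem exists_isTransversal_starProjection_orthogonal {U : Set ℝ} (hU : IsOpen U) {γ : ℝ → E}
    (hγ_norm : ∀ θ ∈ U, ‖γ θ‖ = 1) {θ₀ : ℝ} (hθ₀ : θ₀ ∈ U) {γ' : E}
    (hγ : HasStrictDerivAt γ γ' θ₀) (h0 : γ' ≠ 0) :
    ∃ W ∈ 𝓝 θ₀, IsTransversal (volume.restrict W) (fun θ => (ℝ ∙ γ θ)ᗮ.starProjection) 1 := by
  obtain ⟨K, hK, V, hV, hexpand⟩ := exists_forall_dist_le_mul_dist hγ h0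
  obtain ⟨W, hWVU, hW, hθ₀W⟩ := mem_nhds_iff.1 (inter_mem hV (hU.mem_nhds hθ₀))
  refine ⟨W, hW.mem_nhds hθ₀W, 2 * ENNReal.ofReal (K * 4), by finiteness, fun e he δ _ _ => ?_⟩
  have hcap a : volume {θ | θ ∈ W ∧ dist (γ θ) a ≤ 2 * δ} ≤ ENNReal.ofReal (K * 4 * δ) :=
    (volume_dist_le_le_ofReal hK.le
      (fun x hx y hy => hexpand x (hWVU hx).1 y (hWVU hy).1) a _).trans_eq (by ring_nf)
  have hcover : {θ | ‖(ℝ ∙ γ θ)ᗮ.starProjection e‖ < δ} ∩ W ⊆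
      {θ | θ ∈ W ∧ dist (γ θ) e ≤ 2 * δ} ∪ {θ | θ ∈ W ∧ dist (γ θ) (-e) ≤ 2 * δ} := by
    rintro θ ⟨hθ : ‖(ℝ ∙ γ θ)ᗮ.starProjection e‖ < δ, hθW⟩
    have hu := hγ_norm θ (hWVU hθW).2
    rcases le_total 0 (inner ℝ (γ θ) e) with h | h
    · refine .inl ⟨hθW, ?_⟩
      rw [dist_comm, dist_eq_norm]
      linarith [norm_sub_le_two_mul_norm_starProjection hu he h]
    · refine .inr ⟨hθW, ?_⟩
      have hneg := norm_sub_le_two_mul_norm_starProjection hu ((norm_neg e).trans he)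
        (by rwa [inner_neg_right, neg_nonneg])
      rw [map_neg, norm_neg] at hneg
      rw [dist_comm, dist_eq_norm]
      linarith
  calc volume.restrict W {θ | ‖(ℝ ∙ γ θ)ᗮ.starProjection e‖ < δ}
      ≤ ENNReal.ofReal (K * 4 * δ) + ENNReal.ofReal (K * 4 * δ) := by
        rw [Measure.restrict_apply' hW.measurableSet]
        exact (measure_mono hcover).trans
          ((measure_union_le _ _).trans (add_le_add (hcap e) (hcap (-e))))
    _ = 2 * ENNReal.ofReal (K * 4) * ENNReal.ofReal δ ^ (1 : ℝ) := by
        rw [ENNReal.rpow_one, ENNReal.ofReal_mul (by positivity)]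
        ring

theorem continuousOn_starProjection_orthogonal_singleton {X : Type*} [TopologicalSpace X]
    {U : Set X} {γ : X → E} (hγ : ContinuousOn γ U) (hγ_norm : ∀ x ∈ U, ‖γ x‖ = 1) :
    ContinuousOn (fun x => (ℝ ∙ γ x)ᗮ.starProjection) U := by
  have hmul : Continuous fun u : E => InnerProductSpace.rankOne ℝ u u := by
    simp only [InnerProductSpace.rankOne_def]
    fun_prop
  refine ContinuousOn.congr ?_ fun x hx => starProjection_orthogonal_singleton_eq (hγ_norm x hx)
  exact continuousOn_const.sub (hmul.comp_continuousOn hγ)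

end PlaneProjections

theorem ne_zero_of_span_eq_top {k V : Type*} [Field k] [AddCommGroup V] [Module k V]
    {a b c : V} (h : Submodule.span k {a, b, c} = ⊤) (hV : 2 < Module.finrank k V) : b ≠ 0 := by
  rintro rfl
  rw [Set.insert_comm, Submodule.span_insert_zero] at h
  classical
  have hcard := finrank_span_finset_le_card (R := k) ({a, c} : Finset V)
  rw [Finset.coe_pair, Set.finrank, h, finrank_top] at hcard
  exact (hV.trans_le (hcard.trans Finset.card_le_two)).false

theorem dimH_planeProj_image (γ : ℝ → EuclideanSpace ℝ (Fin 3)) (θ : ℝ)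
    (B : Set (EuclideanSpace ℝ (Fin 3))) :
    dimH (planeProj γ θ '' B) = dimH ((ℝ ∙ γ θ)ᗮ.starProjection '' B) := by
  rw [← (orthPlane γ θ).subtypeₗᵢ.isometry.dimH_image, image_image]
  rfl

theorem proposition1p1_general {U : Set ℝ} {γ : ℝ → EuclideanSpace ℝ (Fin 3)} (hU : IsOpen U)
    (hγ : ContDiffOn ℝ 2 γ U) (hγ_norm : ∀ θ ∈ U, ‖γ θ‖ = 1)
    (hγ_span : ∀ θ ∈ U, Submodule.span ℝ {γ θ, deriv γ θ, deriv (deriv γ) θ} = ⊤)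
    {B : Set (EuclideanSpace ℝ (Fin 3))} (hB : AnalyticSet B) :
    (dimH B ≤ 1 / 2 → ∀ᵐ θ ∂(volume.restrict U), dimH (lineProj γ θ '' B) = dimH B) ∧
    (dimH B ≤ 1 → ∀ᵐ θ ∂(volume.restrict U), dimH (planeProj γ θ '' B) = dimH B) := by
  refine ⟨fun hdim => ?_, fun hdim => ?_⟩
  · exact ae_restrict_dimH_image_eq_of_isTransversal (p := 1 / 2)
      (T := fun θ => innerSL ℝ (γ θ)) hU
      ((innerSL ℝ).continuous.comp_continuousOn hγ.continuousOn)
      (fun θ₀ hθ₀ => by simpa using exists_isTransversal_innerSL hU hγ hθ₀ (hγ_span θ₀ hθ₀)) hB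
      (by simpa using hdim)
  · have htransversal θ₀ (hθ₀ : θ₀ ∈ U) : ∃ W ∈ 𝓝 θ₀,
        IsTransversal (volume.restrict W) (fun θ => (ℝ ∙ γ θ)ᗮ.starProjection) 1 :=
      exists_isTransversal_starProjection_orthogonal hU hγ_norm hθ₀
        ((hγ.contDiffAt (hU.mem_nhds hθ₀)).hasStrictDerivAt two_ne_zero)
        (ne_zero_of_span_eq_top (hγ_span θ₀ hθ₀) (by simp))
    have hae := ae_restrict_dimH_image_eq_of_isTransversal (p := 1) hU
      (continuousOn_starProjection_orthogonal_singleton hγ.continuousOn hγ_norm)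
      (by simpa using htransversal) hB (by simpa using hdim)
    simpa only [dimH_planeProj_image] using hae

theorem proposition1p1 (U : Set ℝ) (γ : ℝ → EuclideanSpace ℝ (Fin 3))
    (hγ : IsNonDegenerateCurve U γ)
    (B : Set (EuclideanSpace ℝ (Fin 3))) (hB : AnalyticSet B) :
    (dimH B ≤ 1 / 2 → ∀ᵐ θ ∂(volume.restrict U), dimH (lineProj γ θ '' B) = dimH B) ∧
    (dimH B ≤ 1 → ∀ᵐ θ ∂(volume.restrict U), dimH (planeProj γ θ '' B) = dimH B) :=
  proposition1p1_general hγ.isOpen (hγ.contDiffOn.of_le (by norm_num)) hγ.norm_eq_one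
    hγ.span_eq_top hB
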